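/- Let $n,m\ge 0$ be integers, $Q_0,\dots,Q_m$ real symmetric $n\times n$ matrices, $c_0,\dots,c_m\in\mathbb{R}^n$, $b\in\mathbb{R}^m$, $\ell\in\mathbb{R}^n_+$, $u\in\mathbb{R}^n$, and write $\langle A,B\rangle=\sum_{i,j}a_{ij}b_{ij}$. Assume that the quadratic program $$(P)\quad \min\ \langle Q_0,xx^T\rangle+c_0^Tx\quad\text{s.t.}\quad \langle Q_r,xx^T\rangle+c_r^Tx\le b_r\ (r=1,\dots,m),\quad \ell_i\le x_i\le u_i\ (i=1,\dots,n)$$ has a feasible point. For $x\in\mathbb{R}^n$, a symmetric $n\times n$ matrix $Y$ and $i\le j$, the McCormick functions are $$\begin{aligned} h^1_{ij}&=Y_{ij}-u_jx_i-\ell_ix_j+u_j\ell_i, & h^2_{ij}&=Y_{ij}-u_ix_j-\ell_jx_i+u_i\ell_j,\\ h^3_{ij}&=-Y_{ij}+u_jx_i+u_ix_j-u_iu_j, & h^4_{ij}&=-Y_{ij}+\ell_jx_i+\ell_ix_j-\ell_i\ell_j, \end{aligned}$$ and for $i<j<k$ the general triangle functions are $$\begin{aligned} h'^{1}_{ijk}&=(\ell_k-u_k)Y_{ij}+(\ell_j-u_j)Y_{ik}-u_iY_{jk}+u_iu_kx_j+(u_ju_k-\ell_j\ell_k)x_i+u_iu_jx_k-u_iu_ju_k,\\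 h'^{2}_{ijk}&=(\ell_k-u_k)Y_{ij}-u_jY_{ik}+(\ell_i-u_i)Y_{jk}+(u_iu_k-\ell_i\ell_k)x_j+u_ju_kx_i+u_iu_jx_k-u_iu_ju_k,\\ h'^{3}_{ijk}&=-u_kY_{ij}+(\ell_j-u_j)Y_{ik}+(\ell_i-u_i)Y_{jk}+u_iu_kx_j+u_ju_kx_i+(u_iu_j-\ell_i\ell_j)x_k-u_iu_ju_k,\\ h'^{4}_{ijk}&=(u_j-\ell_j)Y_{ik}+(\ell_k-u_k)Y_{ij}+u_iY_{jk}+(\ell_ju_k-u_j\ell_k)x_i-u_i\ell_kx_j-u_iu_jx_k+u_iu_j\ell_k,\\ h'^{5}_{ijk}&=u_jY_{ik}+(\ell_k-u_k)Y_{ij}+(u_i-\ell_i)Y_{jk}-u_j\ell_kx_i+(\ell_iu_k-u_i\ell_k)x_j-u_iu_jx_k+u_iu_j\ell_k,\\ h'^{6}_{ijk}&=(u_k-\ell_k)Y_{ij}+u_iY_{jk}+(\ell_j-u_j)Y_{ik}-u_iu_kx_j+(u_j\ell_k-\ell_ju_k)x_i-u_i\ell_jx_k+u_i\ell_ju_k,\\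 h'^{7}_{ijk}&=u_kY_{ij}+(u_i-\ell_i)Y_{jk}+(\ell_j-u_j)Y_{ik}-u_iu_kx_j-\ell_ju_kx_i+(\ell_iu_j-u_i\ell_j)x_k+u_i\ell_ju_k,\\ h'^{8}_{ijk}&=(u_k-\ell_k)Y_{ij}+(\ell_i-u_i)Y_{jk}+u_jY_{ik}+(u_i\ell_k-\ell_iu_k)x_j-u_ju_kx_i-\ell_iu_jx_k+\ell_iu_ju_k,\\ h'^{9}_{ijk}&=u_kY_{ij}+(\ell_i-u_i)Y_{jk}+(u_j-\ell_j)Y_{ik}-\ell_iu_kx_j-u_ju_kx_i+(u_i\ell_j-\ell_iu_j)x_k+\ell_iu_ju_k,\\ h'^{10}_{ijk}&=-u_iY_{jk}+(u_j-\ell_j)Y_{ik}+(u_k-\ell_k)Y_{ij}+u_i\ell_kx_j+(\ell_j\ell_k-u_ju_k)x_i+u_i\ell_jx_k-u_i\ell_j\ell_k,\\ h'^{11}_{ijk}&=(u_i-\ell_i)Y_{jk}-u_jY_{ik}+(u_k-\ell_k)Y_{ij}+(\ell_i\ell_k-u_iu_k)x_j+u_j\ell_kx_i+\ell_iu_jx_k-\ell_iu_j\ell_k,\\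 h'^{12}_{ijk}&=-u_kY_{ij}+(u_i-\ell_i)Y_{jk}+(u_j-\ell_j)Y_{ik}+\ell_iu_kx_j+\ell_ju_kx_i+(\ell_i\ell_j-u_iu_j)x_k-\ell_i\ell_ju_k. \end{aligned}$$ Write $h^t_{ij}(x,Y)=\langle M^t_{ij},Y\rangle+(v^t_{ij})^Tx+l^t_{ij}$ and $h'^t_{ijk}(x,Y)=\langle M'^t_{ijk},Y\rangle+(v'^t_{ijk})^Tx+l'^t_{ijk}$ with symmetric matrices $M^t_{ij},M'^t_{ijk}$. For positive semidefinite $S_0,\dots,S_m$ let $v(P'_{S_0,\dots,S_m})$ be the optimal value of $$\begin{aligned}\min\ &\langle S_0,xx^T\rangle+c_0^Tx+\langle Q_0-S_0,Y\rangle\\ \text{s.t. }&\ell_i\le x_i\le u_i,\quad \langle S_r,xx^T\rangle+c_r^Tx+\langle Q_r-S_r,Y\rangle\le b_r\ (1\le r\le m),\\ &h^t_{ij}(x,Y)\le0\ (i\le j,\ 1\le t\le4),\quad h'^t_{ijk}(x,Y)\le0\ (i<j<k,\ 1\le t\le12),\quad Y_{ji}=Y_{ij}\ (i<j),\end{aligned}$$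 and let $(OPT)$ be the problem of maximizing $v(P'_{S_0,\dots,S_m})$ over all positive semidefinite $S_0,\dots,S_m$. Let $(SDP)$ be the problem $$\begin{aligned}\min\ &\langle Q_0,X\rangle+c_0^Tx\\ \text{s.t. }&\langle Q_r,X\rangle+c_r^Tx\le b_r\ (1\le r\le m),\quad X_{ii}-u_ix_i-\ell_ix_i+u_i\ell_i\le0,\quad -X_{ii}+2u_ix_i-u_i^2\le0,\quad -X_{ii}+2\ell_ix_i-\ell_i^2\le0\ (1\le i\le n),\\ &\begin{pmatrix}1&x^T\\x&X\end{pmatrix}\succeq0,\quad h^t_{ij}(x,X)\le0\ (i<j,\ 1\le t\le4),\quad h'^t_{ijk}(x,X)\le0\ (i<j<k,\ 1\le t\le12),\quad X=X^T.\end{aligned}$$ Its dual $(D)$ has the variables $\alpha_r\ge0$, $\varphi^1,\varphi^2,\varphi^3\in\mathbb{R}^n_+$, $\phi^t_{ij}\ge0$ ($i<j$), $\delta^t_{ijk}\ge0$ ($i<j<k$), associated in this order with the quadratic constraints, the three families of diagonal constraints, the McCormick constraints and the triangle constraints of $(SDP)$, and $\rho\in\mathbb{R}$. With $$\Phi=\sum_{i<j}\sum_{t=1}^4\phi^t_{ij}M^t_{ij}+\mathrm{diag}(\varphi^1-\varphi^2-\varphi^3),\qquad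 \Delta=\sum_{i<j<k}\sum_{t=1}^{12}\delta^t_{ijk}M'^t_{ijk},\qquad S=Q_0+\sum_{r=1}^m\alpha_rQ_r+\Phi+\Delta,$$ $$d=c_0+\sum_{r}\alpha_rc_r+\sum_{i<j,t}\phi^t_{ij}v^t_{ij}+\sum_{i<j<k,t}\delta^t_{ijk}v'^t_{ijk}+\big(-\varphi^1_i(u_i+\ell_i)+2\varphi^2_iu_i+2\varphi^3_i\ell_i\big)_{i=1}^n,$$ it is to maximize $$-\sum_r\alpha_rb_r+\sum_{i<j,t}\phi^t_{ij}l^t_{ij}+\sum_{i<j<k,t}\delta^t_{ijk}l'^t_{ijk}+\sum_i\big(u_i\ell_i\varphi^1_i-u_i^2\varphi^2_i-\ell_i^2\varphi^3_i\big)-\rho\quad\text{s.t.}\quad\begin{pmatrix}\rho&\frac12d^T\\\frac12d&S\end{pmatrix}\succeq0.$$ Let $(\alpha^*,\phi^*,\varphi^{1*},\varphi^{2*},\varphi^{3*},\delta^*,\rho^*)$ be optimal dual variables, that is, an optimal solution of $(D)$, let $\Phi^*,\Delta^*$ be the corresponding matrices, and put $$S_0^*=Q_0+\sum_{r=1}^m\alpha^*_rQ_r+\Phi^*+\Delta^*,\qquad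 S_r^*=0\quad(r=1,\dots,m).$$ Then $S_0^*,\dots,S_m^*$ are positive semidefinite and form an optimal solution of $(OPT)$, so that $v(OPT)=v(P'_{S_0^*,\dots,S_m^*})$, and this value equals $v(SDP)$. Moreover the problem $$\begin{aligned}(P^*)\quad\min\ &\langle S_0^*,xx^T\rangle+c_0^Tx+\Big\langle-\sum_{r=1}^m\alpha^*_rQ_r-\Phi^*-\Delta^*,Y\Big\rangle\\ \text{s.t. }&\langle Q_r,Y\rangle+c_r^Tx\le b_r\ (1\le r\le m),\quad h^t_{ij}(x,Y)\le0\ (i\le j,\ 1\le t\le4),\quad h'^t_{ijk}(x,Y)\le0\ (i<j<k,\ 1\le t\le12),\quad Y_{ji}=Y_{ij}\ (i<j)\end{aligned}$$ has the same optimal value as $(SDP)$. -/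

import Mathlib

open Finset Matrix

noncomputable section

/-- The inner product `⟨A, B⟩ = ∑ i, ∑ j, a_ij * b_ij` of two square matrices. -/
def frob {n : ℕ} (A B : Matrix (Fin n) (Fin n) ℝ) : ℝ := ∑ i, ∑ j, A i j * B i j

/-- The optimal value of `min f z` subject to `z ∈ F`, as an extended real number
(`⊤` if `F` is empty, `⊥` if the problem is unbounded). -/
def optValue {E : Type*} (F : Set E) (f : E → ℝ) : EReal := ⨅ z ∈ F, (f z : EReal)

/-- The data of a quadratically constrained quadratic program in `n` bounded variables with `m`
quadratic constraints: minimize `⟨Q₀, xxᵀ⟩ + c₀ᵀx` subject to `⟨Q_r, xxᵀ⟩ + c_rᵀx ≤ b_r`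
and `l ≤ x ≤ u`, with symmetric matrices. -/
structure QCQP (n m : ℕ) where
  Q₀ : Matrix (Fin n) (Fin n) ℝ
  c₀ : Fin n → ℝ
  Q : Fin m → Matrix (Fin n) (Fin n) ℝ
  c : Fin m → Fin n → ℝ
  b : Fin m → ℝ
  l : Fin n → ℝ
  u : Fin n → ℝ
  symm_Q₀ : Q₀.IsSymm
  symm_Q : ∀ r, (Q r).IsSymm

namespace QCQP

variable {n m : ℕ} (P : QCQP n m)

/-- The feasible domain of the quadratic program `(P)` itself. -/
def feasibleSet : Set (Fin n → ℝ) :=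
  {x | (∀ r, frob (P.Q r) (vecMulVec x x) + P.c r ⬝ᵥ x ≤ P.b r) ∧
    ∀ i, P.l i ≤ x i ∧ x i ≤ P.u i}

/-! ### McCormick and general triangle inequalities -/

/-- The McCormick functions `h^t_ij(x, Y)`, `t = 1, …, 4`. -/
def mc (i j : Fin n) (x : Fin n → ℝ) (Y : Matrix (Fin n) (Fin n) ℝ) : Fin 4 → ℝ :=
  ![Y i j - P.u j * x i - P.l i * x j + P.u j * P.l i,
    Y i j - P.u i * x j - P.l j * x i + P.u i * P.l j,
    -Y i j + P.u j * x i + P.u i * x j - P.u i * P.u j,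
    -Y i j + P.l j * x i + P.l i * x j - P.l i * P.l j]

/-- The general triangle functions `h'^t_ijk(x, Y)`, `t = 1, …, 12`. -/
def tri (i j k : Fin n) (x : Fin n → ℝ) (Y : Matrix (Fin n) (Fin n) ℝ) : Fin 12 → ℝ :=
  let l := P.l
  let u := P.u
  ![(l k - u k) * Y i j + (l j - u j) * Y i k - u i * Y j k + u i * u k * x j
      + (u j * u k - l j * l k) * x i + u i * u j * x k - u i * u j * u k,
    (l k - u k) * Y i j - u j * Y i k + (l i - u i) * Y j k + (u i * u k - l i * l k) * x j
      + u j * u k * x i + u i * u j * x k - u i * u j * u k,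
    -(u k * Y i j) + (l j - u j) * Y i k + (l i - u i) * Y j k + u i * u k * x j
      + u j * u k * x i + (u i * u j - l i * l j) * x k - u i * u j * u k,
    (u j - l j) * Y i k + (l k - u k) * Y i j + u i * Y j k + (l j * u k - u j * l k) * x i
      - u i * l k * x j - u i * u j * x k + u i * u j * l k,
    u j * Y i k + (l k - u k) * Y i j + (u i - l i) * Y j k - u j * l k * x i
      + (l i * u k - u i * l k) * x j - u i * u j * x k + u i * u j * l k,
    (u k - l k) * Y i j + u i * Y j k + (l j - u j) * Y i k - u i * u k * x j
      + (u j * l k - l j * u k) * x i - u i * l j * x k + u i * l j * u k,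
    u k * Y i j + (u i - l i) * Y j k + (l j - u j) * Y i k - u i * u k * x j
      - l j * u k * x i + (l i * u j - u i * l j) * x k + u i * l j * u k,
    (u k - l k) * Y i j + (l i - u i) * Y j k + u j * Y i k + (u i * l k - l i * u k) * x j
      - u j * u k * x i - l i * u j * x k + l i * u j * u k,
    u k * Y i j + (l i - u i) * Y j k + (u j - l j) * Y i k - l i * u k * x j
      - u j * u k * x i + (u i * l j - l i * u j) * x k + l i * u j * u k,
    -(u i * Y j k) + (u j - l j) * Y i k + (u k - l k) * Y i j + u i * l k * x j
      + (l j * l k - u j * u k) * x i + u i * l j * x k - u i * l j * l k,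
    (u i - l i) * Y j k - u j * Y i k + (u k - l k) * Y i j + (l i * l k - u i * u k) * x j
      + u j * l k * x i + l i * u j * x k - l i * u j * l k,
    -(u k * Y i j) + (u i - l i) * Y j k + (u j - l j) * Y i k + l i * u k * x j
      + l j * u k * x i + (l i * l j - u i * u j) * x k - l i * l j * u k]

/-! ### The coefficients `M`, `v`, `l` of these affine functions -/

/-- The symmetric matrix `E` with `⟨E, X⟩ = X_ij` for symmetric `X`. -/
def symE (i j : Fin n) : Matrix (Fin n) (Fin n) ℝ :=
  (1 / 2 : ℝ) • (Matrix.single i j 1 + Matrix.single j i 1)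

/-- The matrices `M^t_ij`. -/
def mcM (i j : Fin n) : Fin 4 → Matrix (Fin n) (Fin n) ℝ :=
  ![symE i j, symE i j, -symE i j, -symE i j]

/-- The vectors `v^t_ij`. -/
def mcV (i j : Fin n) : Fin 4 → Fin n → ℝ :=
  ![Pi.single i (-P.u j) + Pi.single j (-P.l i),
    Pi.single i (-P.l j) + Pi.single j (-P.u i),
    Pi.single i (P.u j) + Pi.single j (P.u i),
    Pi.single i (P.l j) + Pi.single j (P.l i)]

/-- The scalars `l^t_ij`. -/
def mcL (i j : Fin n) : Fin 4 → ℝ :=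
  ![P.u j * P.l i, P.u i * P.l j, -(P.u i * P.u j), -(P.l i * P.l j)]

/-- The coefficients of `Y_ij`, `Y_ik`, `Y_jk` (in this order) in `h'^t_ijk`. -/
def triY (i j k : Fin n) : Fin 12 → Fin 3 → ℝ :=
  let l := P.l
  let u := P.u
  ![![l k - u k, l j - u j, -u i],
    ![l k - u k, -u j, l i - u i],
    ![-u k, l j - u j, l i - u i],
    ![l k - u k, u j - l j, u i],
    ![l k - u k, u j, u i - l i],
    ![u k - l k, l j - u j, u i],
    ![u k, l j - u j, u i - l i],
    ![u k - l k, u j, l i - u i],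
    ![u k, u j - l j, l i - u i],
    ![u k - l k, u j - l j, -u i],
    ![u k - l k, -u j, u i - l i],
    ![-u k, u j - l j, u i - l i]]

/-- The coefficients of `x_i`, `x_j`, `x_k` (in this order) in `h'^t_ijk`. -/
def triX (i j k : Fin n) : Fin 12 → Fin 3 → ℝ :=
  let l := P.l
  let u := P.u
  ![![u j * u k - l j * l k, u i * u k, u i * u j],
    ![u j * u k, u i * u k - l i * l k, u i * u j],
    ![u j * u k, u i * u k, u i * u j - l i * l j],
    ![l j * u k - u j * l k, -(u i * l k), -(u i * u j)],
    ![-(u j * l k), l i * u k - u i * l k, -(u i * u j)],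
    ![u j * l k - l j * u k, -(u i * u k), -(u i * l j)],
    ![-(l j * u k), -(u i * u k), l i * u j - u i * l j],
    ![-(u j * u k), u i * l k - l i * u k, -(l i * u j)],
    ![-(u j * u k), -(l i * u k), u i * l j - l i * u j],
    ![l j * l k - u j * u k, u i * l k, u i * l j],
    ![u j * l k, l i * l k - u i * u k, l i * u j],
    ![l j * u k, l i * u k, l i * l j - u i * u j]]

/-- The matrices `M'^t_ijk`. -/
def triM (i j k : Fin n) (t : Fin 12) : Matrix (Fin n) (Fin n) ℝ :=
  P.triY i j k t 0 • symE i j + P.triY i j k t 1 • symE i k + P.triY i j k t 2 • symE j k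

/-- The vectors `v'^t_ijk`. -/
def triV (i j k : Fin n) (t : Fin 12) : Fin n → ℝ :=
  Pi.single i (P.triX i j k t 0) + Pi.single j (P.triX i j k t 1)
    + Pi.single k (P.triX i j k t 2)

/-- The scalars `l'^t_ijk`. -/
def triL (i j k : Fin n) : Fin 12 → ℝ :=
  let l := P.l
  let u := P.u
  ![-(u i * u j * u k), -(u i * u j * u k), -(u i * u j * u k),
    u i * u j * l k, u i * u j * l k, u i * l j * u k, u i * l j * u k,
    l i * u j * u k, l i * u j * u k, -(u i * l j * l k), -(l i * u j * l k), -(l i * l j * u k)]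

theorem frob_add (A B X : Matrix (Fin n) (Fin n) ℝ) :
    frob (A + B) X = frob A X + frob B X := by
  simp [frob, add_mul, Finset.sum_add_distrib]

theorem frob_smul (a : ℝ) (A X : Matrix (Fin n) (Fin n) ℝ) :
    frob (a • A) X = a * frob A X := by
  simp [frob, Finset.mul_sum, mul_assoc]

theorem frob_neg (A X : Matrix (Fin n) (Fin n) ℝ) : frob (-A) X = -frob A X := by
  simp [frob]

theorem frob_single (i j : Fin n) (X : Matrix (Fin n) (Fin n) ℝ) :
    frob (Matrix.single i j 1) X = X i j := by
  simp [frob, Matrix.single_apply, ite_and]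

theorem frob_symE (i j : Fin n) {X : Matrix (Fin n) (Fin n) ℝ} (hX : X.IsSymm) :
    frob (symE i j) X = X i j := by
  rw [symE, frob_smul, frob_add, frob_single, frob_single, hX.apply i j]
  ring

theorem symE_isSymm (i j : Fin n) : (symE i j).IsSymm := by
  simp [symE, Matrix.IsSymm, Matrix.transpose_add, add_comm]

/-- `M^t_ij`, `v^t_ij`, `l^t_ij` are the coefficients of `h^t_ij`. -/
theorem mc_eq (i j : Fin n) (t : Fin 4) (x : Fin n → ℝ) {X : Matrix (Fin n) (Fin n) ℝ}
    (hX : X.IsSymm) :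
    P.mc i j x X t = frob (mcM i j t) X + P.mcV i j t ⬝ᵥ x + P.mcL i j t := by
  fin_cases t <;>
    simp [mc, mcM, mcV, mcL, frob_neg, frob_symE i j hX, add_dotProduct,
      single_dotProduct] <;> ring

/-- `M'^t_ijk`, `v'^t_ijk`, `l'^t_ijk` are the coefficients of `h'^t_ijk`. -/
theorem tri_eq (i j k : Fin n) (t : Fin 12) (x : Fin n → ℝ) {X : Matrix (Fin n) (Fin n) ℝ}
    (hX : X.IsSymm) :
    P.tri i j k x X t = frob (P.triM i j k t) X + P.triV i j k t ⬝ᵥ x + P.triL i j k t := by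
  simp only [triM, triV, frob_add, frob_smul, frob_symE i j hX, frob_symE i k hX,
    frob_symE j k hX, add_dotProduct, single_dotProduct]
  fin_cases t <;> simp [tri, triY, triX, triL] <;> ring

/-! ### The family of quadratic convex relaxations and the problem `(OPT)` -/

/-- The feasible set of `(P'_{S₀,…,S_m})`. It does not depend on `S₀`. -/
def relaxFeasible (S : Fin m → Matrix (Fin n) (Fin n) ℝ) :
    Set ((Fin n → ℝ) × Matrix (Fin n) (Fin n) ℝ) :=
  {z | (∀ i, P.l i ≤ z.1 i ∧ z.1 i ≤ P.u i) ∧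
    (∀ r, frob (S r) (vecMulVec z.1 z.1) + P.c r ⬝ᵥ z.1 + frob (P.Q r - S r) z.2 ≤ P.b r) ∧
    (∀ i j, i ≤ j → ∀ t, P.mc i j z.1 z.2 t ≤ 0) ∧
    (∀ i j k, i < j → j < k → ∀ t, P.tri i j k z.1 z.2 t ≤ 0) ∧
    (∀ i j, i < j → z.2 j i = z.2 i j)}

/-- The optimal value `v(P'_{S₀,…,S_m})`. -/
def relaxValue (S₀ : Matrix (Fin n) (Fin n) ℝ) (S : Fin m → Matrix (Fin n) (Fin n) ℝ) : EReal :=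
  optValue (P.relaxFeasible S)
    (fun z => frob S₀ (vecMulVec z.1 z.1) + P.c₀ ⬝ᵥ z.1 + frob (P.Q₀ - S₀) z.2)

/-- Feasible points of `(OPT)`: all the matrices `S₀, …, S_m` are positive semidefinite. -/
def OptFeasible (S₀ : Matrix (Fin n) (Fin n) ℝ) (S : Fin m → Matrix (Fin n) (Fin n) ℝ) : Prop :=
  S₀.PosSemidef ∧ ∀ r, (S r).PosSemidef

/-- The optimal value `v(OPT)` of the maximization problem `(OPT)`. -/
def optOptValue : EReal :=
  ⨆ (S₀ : Matrix (Fin n) (Fin n) ℝ) (S : Fin m → Matrix (Fin n) (Fin n) ℝ)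
    (_ : OptFeasible S₀ S), P.relaxValue S₀ S

/-- `(S₀, …, S_m)` is an optimal solution of `(OPT)`. -/
def IsOptSolution (S₀ : Matrix (Fin n) (Fin n) ℝ) (S : Fin m → Matrix (Fin n) (Fin n) ℝ) :
    Prop :=
  OptFeasible S₀ S ∧ ∀ S₀' S', OptFeasible S₀' S' → P.relaxValue S₀' S' ≤ P.relaxValue S₀ S

/-! ### The semidefinite relaxation `(SDP)` -/

/-- The block matrix with rows `(ρ, wᵀ)` and `(w, X)`. -/
def bordered (ρ : ℝ) (w : Fin n → ℝ) (X : Matrix (Fin n) (Fin n) ℝ) :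
    Matrix (Unit ⊕ Fin n) (Unit ⊕ Fin n) ℝ :=
  Matrix.fromBlocks (Matrix.of fun _ _ => ρ) (Matrix.of fun _ i => w i)
    (Matrix.of fun i _ => w i) X

/-- The feasible set of the "Shor plus RLT plus Triangle" semidefinite relaxation. -/
def sdpFeasible : Set ((Fin n → ℝ) × Matrix (Fin n) (Fin n) ℝ) :=
  {z | (∀ r, frob (P.Q r) z.2 + P.c r ⬝ᵥ z.1 ≤ P.b r) ∧
    (∀ i, z.2 i i - P.u i * z.1 i - P.l i * z.1 i + P.u i * P.l i ≤ 0) ∧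
    (∀ i, -z.2 i i + 2 * P.u i * z.1 i - P.u i ^ 2 ≤ 0) ∧
    (∀ i, -z.2 i i + 2 * P.l i * z.1 i - P.l i ^ 2 ≤ 0) ∧
    z.2.IsSymm ∧
    (bordered 1 z.1 z.2).PosSemidef ∧
    (∀ i j, i < j → ∀ t, P.mc i j z.1 z.2 t ≤ 0) ∧
    (∀ i j k, i < j → j < k → ∀ t, P.tri i j k z.1 z.2 t ≤ 0)}

/-- The optimal value `v(SDP)`. -/
def sdpValue : EReal :=
  optValue P.sdpFeasible (fun z => frob P.Q₀ z.2 + P.c₀ ⬝ᵥ z.1)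

/-! ### The dual `(D)` of `(SDP)` -/

/-- The dual variables of `(SDP)`: `α` for the quadratic constraints, `φ i j t` (only `i < j`
matters) for the McCormick constraints, `φ₁, φ₂, φ₃` for the three families of constraints on the
diagonal of `X`, `δ i j k t` (only `i < j < k` matters) for the triangle constraints, and `ρ`. -/
structure DualVars (n m : ℕ) where
  α : Fin m → ℝ
  φ : Fin n → Fin n → Fin 4 → ℝ
  φ₁ : Fin n → ℝ
  φ₂ : Fin n → ℝ
  φ₃ : Fin n → ℝ
  δ : Fin n → Fin n → Fin n → Fin 12 → ℝ
  ρ : ℝ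

/-- `Φ = ∑_{i<j} ∑_t φ^t_ij M^t_ij + diag(φ¹ - φ² - φ³)`. -/
def Phi (D : DualVars n m) : Matrix (Fin n) (Fin n) ℝ :=
  (∑ i, ∑ j ∈ Finset.Ioi i, ∑ t, D.φ i j t • mcM i j t)
    + Matrix.diagonal (D.φ₁ - D.φ₂ - D.φ₃)

/-- `Δ = ∑_{i<j<k} ∑_t δ^t_ijk M'^t_ijk`. -/
def Delta (D : DualVars n m) : Matrix (Fin n) (Fin n) ℝ :=
  ∑ i, ∑ j ∈ Finset.Ioi i, ∑ k ∈ Finset.Ioi j, ∑ t, D.δ i j k t • P.triM i j k t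

/-- `S = Q₀ + ∑_r α_r Q_r + Φ + Δ`. -/
def dualS (D : DualVars n m) : Matrix (Fin n) (Fin n) ℝ :=
  P.Q₀ + ∑ r, D.α r • P.Q r + Phi D + P.Delta D

/-- The coefficient vector `d` of `x` in the Lagrangian. -/
def dualD (D : DualVars n m) : Fin n → ℝ :=
  P.c₀ + ∑ r, D.α r • P.c r
    + (∑ i, ∑ j ∈ Finset.Ioi i, ∑ t, D.φ i j t • P.mcV i j t)
    + (∑ i, ∑ j ∈ Finset.Ioi i, ∑ k ∈ Finset.Ioi j, ∑ t, D.δ i j k t • P.triV i j k t)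
    - D.φ₁ * (P.u + P.l) + (2 : ℝ) • (D.φ₂ * P.u) + (2 : ℝ) • (D.φ₃ * P.l)

/-- The objective function of `(D)`. -/
def dualObj (D : DualVars n m) : ℝ :=
  -(∑ r, D.α r * P.b r)
    + (∑ i, ∑ j ∈ Finset.Ioi i, ∑ t, D.φ i j t * P.mcL i j t)
    + (∑ i, ∑ j ∈ Finset.Ioi i, ∑ k ∈ Finset.Ioi j, ∑ t, D.δ i j k t * P.triL i j k t)
    + (∑ i, P.u i * P.l i * D.φ₁ i) - (∑ i, P.u i ^ 2 * D.φ₂ i)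
    - (∑ i, P.l i ^ 2 * D.φ₃ i) - D.ρ

/-- Feasibility for `(D)`. -/
def DualFeasible (D : DualVars n m) : Prop :=
  (∀ r, 0 ≤ D.α r) ∧
  (∀ i j, i < j → ∀ t, 0 ≤ D.φ i j t) ∧
  (∀ i, 0 ≤ D.φ₁ i) ∧ (∀ i, 0 ≤ D.φ₂ i) ∧ (∀ i, 0 ≤ D.φ₃ i) ∧
  (∀ i j k, i < j → j < k → ∀ t, 0 ≤ D.δ i j k t) ∧
  (bordered D.ρ ((1 / 2 : ℝ) • P.dualD D) (P.dualS D)).PosSemidef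

/-- `D` consists of optimal dual variables of `(SDP)`: it is an optimal solution of `(D)`. -/
def IsDualOptimal (D : DualVars n m) : Prop :=
  P.DualFeasible D ∧ ∀ D', P.DualFeasible D' → P.dualObj D' ≤ P.dualObj D

/-! ### The relaxation `(P*)` -/

/-- The feasible set of `(P*)`. -/
def starFeasible : Set ((Fin n → ℝ) × Matrix (Fin n) (Fin n) ℝ) :=
  {z | (∀ r, frob (P.Q r) z.2 + P.c r ⬝ᵥ z.1 ≤ P.b r) ∧
    (∀ i j, i ≤ j → ∀ t, P.mc i j z.1 z.2 t ≤ 0) ∧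
    (∀ i j k, i < j → j < k → ∀ t, P.tri i j k z.1 z.2 t ≤ 0) ∧
    (∀ i j, i < j → z.2 j i = z.2 i j)}

/-- The optimal value of `(P*)` built from the dual variables `D`. -/
def starValue (D : DualVars n m) : EReal :=
  optValue P.starFeasible
    (fun z => frob (P.Q₀ + ∑ r, D.α r • P.Q r + Phi D + P.Delta D) (vecMulVec z.1 z.1)
      + P.c₀ ⬝ᵥ z.1 + frob (-(∑ r, D.α r • P.Q r) - Phi D - P.Delta D) z.2)

end QCQP

end

/-! ### Algebra of the Frobenius product. -/

noncomputable section

/-! Four inequalities close into a cycle, v(SDP) ≤ v(D) ≤ v(P*) ≤ v(P'_{S*}) ≤ v(SDP), where v(D) is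
the dual value of `D`; all four values are therefore equal. The last inequality holds for every
choice of positive semidefinite matrices, so `S*` is a maximizer of (OPT).

Three of the links are elementary. For v(D) ≤ v(P*) (`dualObj_le_starValue`), the Lagrangian is at
most the primal objective, and the dual semidefinite constraint is tested on the vector (1, x). For
v(P*) ≤ v(P'_{S*}) (`starValue_le_relaxValue`), the two objectives agree and (P*) only drops the
box. For v(P') ≤ v(SDP) (`relaxValue_le_sdpValue`), a feasible point of (SDP) has X - xxᵀ ⪰ 0, so
replacing X by xxᵀ in a product with a positive semidefinite matrix can only decrease it.

The substance is v(SDP) ≤ v(D). A Slater point need not exist (some `l i = u i` is allowed), but the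
upper diagonal constraints, whose sum is `diagSum`, bound the feasible set. On the compact slice
`diagSum ≤ R` of the semidefinite set, separation yields multipliers (`exists_multipliers`). Beyond
the slice the resulting affine function falls at most linearly in `diagSum`
(`nonneg_add_mul_of_nonneg_of_le`), so a small multiple of `diagSum`, absorbed into φ¹, repairs it
at a cost that vanishes as R grows. An affine function nonnegative on the whole semidefinite set is
exactly a dual certificate (`bordered_posSemidef_of_nonneg`). -/

theorem frob_comm {n : ℕ} (A B : Matrix (Fin n) (Fin n) ℝ) : frob A B = frob B A := by
  simp [frob, mul_comm]

theorem frob_zero_left {n : ℕ} (X : Matrix (Fin n) (Fin n) ℝ) : frob 0 X = 0 := by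
  simp [frob]

theorem frob_sub_left {n : ℕ} (A B X : Matrix (Fin n) (Fin n) ℝ) :
    frob (A - B) X = frob A X - frob B X := by
  rw [sub_eq_add_neg, QCQP.frob_add, QCQP.frob_neg, sub_eq_add_neg]

theorem frob_sub_right {n : ℕ} (A X Y : Matrix (Fin n) (Fin n) ℝ) :
    frob A (X - Y) = frob A X - frob A Y := by
  rw [frob_comm, frob_sub_left, frob_comm X, frob_comm Y]

theorem frob_add_right {n : ℕ} (A X Y : Matrix (Fin n) (Fin n) ℝ) :
    frob A (X + Y) = frob A X + frob A Y := by
  rw [frob_comm, QCQP.frob_add, frob_comm X, frob_comm Y]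

theorem frob_smul_right {n : ℕ} (a : ℝ) (A X : Matrix (Fin n) (Fin n) ℝ) :
    frob A (a • X) = a * frob A X := by
  rw [frob_comm, QCQP.frob_smul, frob_comm]

theorem frob_sum_left {n : ℕ} {ι : Type*} (s : Finset ι) (A : ι → Matrix (Fin n) (Fin n) ℝ)
    (X : Matrix (Fin n) (Fin n) ℝ) : frob (∑ i ∈ s, A i) X = ∑ i ∈ s, frob (A i) X := by
  classical
  induction s using Finset.induction_on with
  | empty => simp [frob_zero_left]
  | insert a s ha ih => rw [Finset.sum_insert ha, Finset.sum_insert ha, QCQP.frob_add, ih]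

theorem frob_diagonal {n : ℕ} (a : Fin n → ℝ) (X : Matrix (Fin n) (Fin n) ℝ) :
    frob (Matrix.diagonal a) X = ∑ i, a i * X i i := by
  simp [frob, Matrix.diagonal_apply, ite_mul]

theorem frob_vecMulVec {n : ℕ} (A : Matrix (Fin n) (Fin n) ℝ) (y : Fin n → ℝ) :
    frob A (vecMulVec y y) = y ⬝ᵥ A *ᵥ y := by
  simp only [frob, vecMulVec_apply, dotProduct, mulVec, Finset.mul_sum]
  exact Finset.sum_congr rfl fun i _ => Finset.sum_congr rfl fun j _ => by ring

theorem vecMulVec_self_isSymm {n : ℕ} (y : Fin n → ℝ) : (vecMulVec y y).IsSymm := by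
  ext i j
  simp [vecMulVec_apply, mul_comm]

/-- The Frobenius product of two positive semidefinite matrices is nonnegative. -/
theorem frob_nonneg {n : ℕ} {A B : Matrix (Fin n) (Fin n) ℝ} (hA : A.PosSemidef)
    (hB : B.PosSemidef) : 0 ≤ frob A B := by
  -- Schur product theorem: the quadratic form of A ∘ B at the all-ones vector is the Frobenius
  -- product.
  have h := (hA.hadamard hB).dotProduct_mulVec_nonneg 1
  simpa [frob, dotProduct, mulVec] using h

/-! ### Bordered positive semidefinite matrices. -/

namespace QCQP

variable {n m : ℕ} (P : QCQP n m)

theorem bordered_dotProduct (ρ : ℝ) (w : Fin n → ℝ) (X : Matrix (Fin n) (Fin n) ℝ)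
    (z : Unit ⊕ Fin n → ℝ) :
    z ⬝ᵥ bordered ρ w X *ᵥ z = ρ * z (Sum.inl ()) ^ 2
      + 2 * z (Sum.inl ()) * (w ⬝ᵥ fun i => z (Sum.inr i))
      + frob X (vecMulVec (fun i => z (Sum.inr i)) fun i => z (Sum.inr i)) := by
  simp only [frob_vecMulVec, dotProduct, mulVec, bordered, Fintype.sum_sum_type,
    Finset.univ_unique, Finset.sum_singleton, fromBlocks_apply₁₁, fromBlocks_apply₁₂,
    fromBlocks_apply₂₁, fromBlocks_apply₂₂, of_apply, PUnit.default_eq_unit, mul_add,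
    Finset.sum_add_distrib]
  have h : ∑ i, z (Sum.inr i) * (w i * z (Sum.inl ()))
      = z (Sum.inl ()) * ∑ i, w i * z (Sum.inr i) := by
    rw [Finset.mul_sum]
    exact Finset.sum_congr rfl fun i _ => by ring
  rw [h]
  ring

/-- Each condition on the right is linear in (ρ, w, X), which later gives convexity and closedness
of `psdSet`. -/
theorem bordered_posSemidef_iff (ρ : ℝ) (w : Fin n → ℝ) (X : Matrix (Fin n) (Fin n) ℝ) :
    (bordered ρ w X).PosSemidef ↔ X.IsSymm ∧
      ∀ (t : ℝ) (y : Fin n → ℝ), 0 ≤ ρ * t ^ 2 + 2 * t * (w ⬝ᵥ y) + frob X (vecMulVec y y) := by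
  rw [posSemidef_iff_dotProduct_mulVec]
  refine and_congr ?_ ?_
  · constructor
    · intro h
      ext i j
      simpa [bordered] using h.apply (Sum.inr i) (Sum.inr j)
    · intro h
      refine IsHermitian.ext fun a b => ?_
      rcases a with a | a <;> rcases b with b | b <;> simp [bordered]
      exact h.apply a b
  · constructor
    · intro h t y
      have := h (Sum.elim (fun _ => t) y)
      rw [star_trivial, bordered_dotProduct] at this
      simpa using this
    · intro h z
      rw [star_trivial, bordered_dotProduct]
      exact h _ _

theorem bordered_one_posSemidef_vecMulVec (x : Fin n → ℝ) :
    (bordered 1 x (vecMulVec x x)).PosSemidef := by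
  refine (bordered_posSemidef_iff _ _ _).2 ⟨vecMulVec_self_isSymm x, fun t y => ?_⟩
  have : frob (vecMulVec x x) (vecMulVec y y) = (x ⬝ᵥ y) ^ 2 := by
    rw [frob_vecMulVec, vecMulVec_mulVec, dotProduct_smul, dotProduct_comm y x]
    simp [sq]
  rw [this]
  nlinarith [sq_nonneg (t + x ⬝ᵥ y)]

theorem posSemidef_of_bordered {ρ : ℝ} {w : Fin n → ℝ} {X : Matrix (Fin n) (Fin n) ℝ}
    (h : (bordered ρ w X).PosSemidef) : X.PosSemidef := by
  rw [bordered_posSemidef_iff] at h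
  refine PosSemidef.of_dotProduct_mulVec_nonneg (isHermitian_iff_isSymm.2 h.1) fun y => ?_
  have := h.2 0 y
  rw [frob_vecMulVec] at this
  simpa using this

theorem posSemidef_sub_of_bordered {x : Fin n → ℝ} {X : Matrix (Fin n) (Fin n) ℝ}
    (h : (bordered 1 x X).PosSemidef) : (X - vecMulVec x x).PosSemidef := by
  rw [bordered_posSemidef_iff] at h
  refine PosSemidef.of_dotProduct_mulVec_nonneg ?_ fun y => ?_
  · exact isHermitian_iff_isSymm.2 (h.1.sub (vecMulVec_self_isSymm x))
  -- Schur complement: this value of t minimizes the quadratic form for fixed y.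
  have h1 := h.2 (-(x ⬝ᵥ y)) y
  have h2 : y ⬝ᵥ vecMulVec x x *ᵥ y = (x ⬝ᵥ y) ^ 2 := by
    rw [vecMulVec_mulVec, dotProduct_smul, dotProduct_comm y x]
    simp [sq]
  rw [frob_vecMulVec] at h1
  rw [star_trivial, sub_mulVec, dotProduct_sub, h2]
  nlinarith

theorem sq_le_diag_of_bordered {x : Fin n → ℝ} {X : Matrix (Fin n) (Fin n) ℝ}
    (h : (bordered 1 x X).PosSemidef) (i : Fin n) : x i ^ 2 ≤ X i i := by
  have := (posSemidef_sub_of_bordered h).diag_nonneg (i := i)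
  simp [vecMulVec_apply] at this
  nlinarith

theorem two_mul_abs_le_of_posSemidef {X : Matrix (Fin n) (Fin n) ℝ}
    (h : X.PosSemidef) (i j : Fin n) : 2 * |X i j| ≤ X i i + X j j := by
  have hs : X j i = X i j := by simpa using h.1.apply i j
  -- The test vectors e_i ± e_j bound the entry from both sides.
  have h1 := h.dotProduct_mulVec_nonneg (Pi.single i 1 + Pi.single j 1)
  have h2 := h.dotProduct_mulVec_nonneg (Pi.single i 1 - Pi.single j 1)
  simp [mulVec_add, mulVec_sub, add_dotProduct, sub_dotProduct, hs] at h1 h2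
  rcases abs_cases (X i j) with h | h <;> linarith

/-! ### The Lagrangian -/

/-- The Lagrangian of `(SDP)` without the semidefinite constraint. -/
def lagrangian (D : DualVars n m) (x : Fin n → ℝ) (X : Matrix (Fin n) (Fin n) ℝ) : ℝ :=
  frob P.Q₀ X + P.c₀ ⬝ᵥ x
    + (∑ r, D.α r * (frob (P.Q r) X + P.c r ⬝ᵥ x - P.b r))
    + (∑ i, ∑ j ∈ Finset.Ioi i, ∑ t, D.φ i j t * P.mc i j x X t)
    + (∑ i, ∑ j ∈ Finset.Ioi i, ∑ k ∈ Finset.Ioi j, ∑ t, D.δ i j k t * P.tri i j k x X t)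
    + (∑ i, D.φ₁ i * (X i i - P.u i * x i - P.l i * x i + P.u i * P.l i))
    + (∑ i, D.φ₂ i * (-X i i + 2 * P.u i * x i - P.u i ^ 2))
    + (∑ i, D.φ₃ i * (-X i i + 2 * P.l i * x i - P.l i ^ 2))

/-- Collects coefficients. The dual objective already has ρ subtracted, so ρ is added back to obtain
the constant term. -/
theorem lagrangian_eq (D : DualVars n m) (x : Fin n → ℝ) {X : Matrix (Fin n) (Fin n) ℝ}
    (hX : X.IsSymm) :
    P.lagrangian D x X
      = frob (P.dualS D) X + P.dualD D ⬝ᵥ x + (P.dualObj D + D.ρ) := by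
  have h1 : frob (∑ r, D.α r • P.Q r) X = ∑ r, D.α r * frob (P.Q r) X := by
    simp only [frob_sum_left, frob_smul]
  have h2 : frob (Phi D) X = (∑ i, ∑ j ∈ Finset.Ioi i, ∑ t, D.φ i j t * frob (mcM i j t) X)
      + ((∑ i, D.φ₁ i * X i i) - (∑ i, D.φ₂ i * X i i) - (∑ i, D.φ₃ i * X i i)) := by
    simp only [Phi, frob_add, frob_sum_left, frob_smul, frob_diagonal, Pi.sub_apply, sub_mul,
      Finset.sum_sub_distrib]
  have h3 : frob (P.Delta D) X = ∑ i, ∑ j ∈ Finset.Ioi i, ∑ k ∈ Finset.Ioi j, ∑ t,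
      D.δ i j k t * frob (P.triM i j k t) X := by
    simp only [Delta, frob_sum_left, frob_smul]
  have h4 : (D.φ₁ * (P.u + P.l)) ⬝ᵥ x
      = (∑ i, D.φ₁ i * (P.u i * x i)) + ∑ i, D.φ₁ i * (P.l i * x i) := by
    simp only [dotProduct, Pi.mul_apply, Pi.add_apply, ← Finset.sum_add_distrib]
    exact Finset.sum_congr rfl fun i _ => by ring
  have h5 : (D.φ₂ * P.u) ⬝ᵥ x = ∑ i, D.φ₂ i * (P.u i * x i) := by
    simp only [dotProduct, Pi.mul_apply, mul_assoc]
  have h6 : (D.φ₃ * P.l) ⬝ᵥ x = ∑ i, D.φ₃ i * (P.l i * x i) := by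
    simp only [dotProduct, Pi.mul_apply, mul_assoc]
  have h7 : ∑ i, D.φ₁ i * (X i i - P.u i * x i - P.l i * x i + P.u i * P.l i)
      = (∑ i, D.φ₁ i * X i i) - (∑ i, D.φ₁ i * (P.u i * x i)) - (∑ i, D.φ₁ i * (P.l i * x i))
        + ∑ i, P.u i * P.l i * D.φ₁ i := by
    simp only [← Finset.sum_add_distrib, ← Finset.sum_sub_distrib]
    exact Finset.sum_congr rfl fun i _ => by ring
  have h8 : ∑ i, D.φ₂ i * (-X i i + 2 * P.u i * x i - P.u i ^ 2)
      = -(∑ i, D.φ₂ i * X i i) + 2 * (∑ i, D.φ₂ i * (P.u i * x i))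
        - ∑ i, P.u i ^ 2 * D.φ₂ i := by
    simp only [Finset.mul_sum, ← Finset.sum_add_distrib, ← Finset.sum_sub_distrib,
      ← Finset.sum_neg_distrib]
    exact Finset.sum_congr rfl fun i _ => by ring
  have h9 : ∑ i, D.φ₃ i * (-X i i + 2 * P.l i * x i - P.l i ^ 2)
      = -(∑ i, D.φ₃ i * X i i) + 2 * (∑ i, D.φ₃ i * (P.l i * x i))
        - ∑ i, P.l i ^ 2 * D.φ₃ i := by
    simp only [Finset.mul_sum, ← Finset.sum_add_distrib, ← Finset.sum_sub_distrib,
      ← Finset.sum_neg_distrib]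
    exact Finset.sum_congr rfl fun i _ => by ring
  rw [lagrangian, h7, h8, h9]
  simp only [dualS, dualD, dualObj, frob_add, h1, h2, h3, add_dotProduct, sub_dotProduct,
    smul_dotProduct, sum_dotProduct, h4, h5, h6]
  simp only [P.mc_eq _ _ _ x hX, P.tri_eq _ _ _ _ x hX, mul_add, mul_sub,
    Finset.sum_add_distrib, Finset.sum_sub_distrib, smul_eq_mul]
  ring

/-- The Lagrangian lies below the objective where the constraints hold. -/
theorem lagrangian_le {D : DualVars n m} (hD : P.DualFeasible D) {x : Fin n → ℝ}
    {X : Matrix (Fin n) (Fin n) ℝ}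
    (hq : ∀ r, frob (P.Q r) X + P.c r ⬝ᵥ x ≤ P.b r)
    (h1 : ∀ i, X i i - P.u i * x i - P.l i * x i + P.u i * P.l i ≤ 0)
    (h2 : ∀ i, -X i i + 2 * P.u i * x i - P.u i ^ 2 ≤ 0)
    (h3 : ∀ i, -X i i + 2 * P.l i * x i - P.l i ^ 2 ≤ 0)
    (hmc : ∀ i j, i < j → ∀ t, P.mc i j x X t ≤ 0)
    (htri : ∀ i j k, i < j → j < k → ∀ t, P.tri i j k x X t ≤ 0) :
    P.lagrangian D x X ≤ frob P.Q₀ X + P.c₀ ⬝ᵥ x := by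
  obtain ⟨hα, hφ, hφ1, hφ2, hφ3, hδ, -⟩ := hD
  have a1 : ∑ r, D.α r * (frob (P.Q r) X + P.c r ⬝ᵥ x - P.b r) ≤ 0 :=
    Finset.sum_nonpos fun r _ => mul_nonpos_of_nonneg_of_nonpos (hα r) (sub_nonpos.2 (hq r))
  have a2 : ∑ i, ∑ j ∈ Finset.Ioi i, ∑ t, D.φ i j t * P.mc i j x X t ≤ 0 :=
    Finset.sum_nonpos fun i _ => Finset.sum_nonpos fun j hj => Finset.sum_nonpos fun t _ =>
      mul_nonpos_of_nonneg_of_nonpos (hφ i j (Finset.mem_Ioi.1 hj) t)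
        (hmc i j (Finset.mem_Ioi.1 hj) t)
  have a3 : ∑ i, ∑ j ∈ Finset.Ioi i, ∑ k ∈ Finset.Ioi j, ∑ t,
      D.δ i j k t * P.tri i j k x X t ≤ 0 :=
    Finset.sum_nonpos fun i _ => Finset.sum_nonpos fun j hj => Finset.sum_nonpos fun k hk =>
      Finset.sum_nonpos fun t _ => mul_nonpos_of_nonneg_of_nonpos
        (hδ i j k (Finset.mem_Ioi.1 hj) (Finset.mem_Ioi.1 hk) t)
        (htri i j k (Finset.mem_Ioi.1 hj) (Finset.mem_Ioi.1 hk) t)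
  have a4 := Finset.sum_nonpos (s := Finset.univ)
    fun i _ => mul_nonpos_of_nonneg_of_nonpos (hφ1 i) (h1 i)
  have a5 := Finset.sum_nonpos (s := Finset.univ)
    fun i _ => mul_nonpos_of_nonneg_of_nonpos (hφ2 i) (h2 i)
  have a6 := Finset.sum_nonpos (s := Finset.univ)
    fun i _ => mul_nonpos_of_nonneg_of_nonpos (hφ3 i) (h3 i)
  unfold lagrangian
  linarith

/-! ### The elementary inequalities between the optimal values. -/

/-- For i = j the first two McCormick functions coincide, so the four inequalities become the three
diagonal families of (SDP). -/
theorem mc_diag_le_zero_iff (i : Fin n) (x : Fin n → ℝ) (Y : Matrix (Fin n) (Fin n) ℝ) :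
    (∀ t, P.mc i i x Y t ≤ 0) ↔
      Y i i - P.u i * x i - P.l i * x i + P.u i * P.l i ≤ 0 ∧
      -Y i i + 2 * P.u i * x i - P.u i ^ 2 ≤ 0 ∧
      -Y i i + 2 * P.l i * x i - P.l i ^ 2 ≤ 0 := by
  constructor
  · intro h
    have h0 := h 0
    have h2 := h 2
    have h3 := h 3
    simp [mc] at h0 h2 h3
    exact ⟨by linarith, by linarith, by linarith⟩
  · rintro ⟨h1, h2, h3⟩ t
    fin_cases t <;> simp [mc] <;> linarith

theorem isSymm_of_lt {Y : Matrix (Fin n) (Fin n) ℝ} (h : ∀ i j, i < j → Y j i = Y i j) :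
    Y.IsSymm := by
  refine IsSymm.ext fun i j => ?_
  rcases lt_trichotomy i j with hij | rfl | hij
  · exact h i j hij
  · rfl
  · exact (h j i hij).symm

theorem optValue_mono {E : Type*} {F G : Set E} (f : E → ℝ) (h : F ⊆ G) :
    optValue G f ≤ optValue F f :=
  biInf_mono fun _ hz => h hz

/-- Weak duality between `(P*)` and `(D)`. -/
theorem dualObj_le_starValue {D : DualVars n m} (hD : P.DualFeasible D) :
    (P.dualObj D : EReal) ≤ P.starValue D := by
  refine le_iInf₂ fun z hz => ?_
  obtain ⟨x, Y⟩ := z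
  obtain ⟨hq, hmc, htri, hs⟩ := hz
  have hY : Y.IsSymm := isSymm_of_lt hs
  have hdiag := fun i => (P.mc_diag_le_zero_iff i x Y).1 (hmc i i le_rfl)
  have h := P.lagrangian_le hD hq (fun i => (hdiag i).1) (fun i => (hdiag i).2.1)
    (fun i => (hdiag i).2.2) (fun i j hij => hmc i j hij.le) htri
  rw [P.lagrangian_eq D x hY] at h
  -- Testing on (1, x) gives ρ + dᵀx + ⟨S, xxᵀ⟩ ≥ 0. No relation between Y and xxᵀ is required.
  have hpsd := ((bordered_posSemidef_iff _ _ _).1 hD.2.2.2.2.2.2).2 1 x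
  rw [smul_dotProduct, smul_eq_mul] at hpsd
  have hS : frob (-(∑ r, D.α r • P.Q r) - Phi D - P.Delta D) Y
      = frob P.Q₀ Y - frob (P.dualS D) Y := by
    rw [← frob_sub_left]
    congr 1
    rw [dualS]
    abel
  rw [EReal.coe_le_coe_iff]
  change _ ≤ frob (P.dualS D) (vecMulVec x x) + P.c₀ ⬝ᵥ x
    + frob (-(∑ r, D.α r • P.Q r) - Phi D - P.Delta D) Y
  rw [hS]
  linarith

theorem starValue_le_relaxValue (D : DualVars n m) :
    P.starValue D ≤
      P.relaxValue (P.Q₀ + ∑ r, D.α r • P.Q r + Phi D + P.Delta D) (fun _ => 0) := by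
  have hsub : P.relaxFeasible (fun _ => 0) ⊆ P.starFeasible := by
    rintro ⟨x, Y⟩ ⟨-, hq, hmc, htri, hs⟩
    refine ⟨fun r => ?_, hmc, htri, hs⟩
    have := hq r
    simp only [frob_zero_left, sub_zero] at this
    linarith
  have hobj : (P.Q₀ - (P.Q₀ + ∑ r, D.α r • P.Q r + Phi D + P.Delta D))
      = -(∑ r, D.α r • P.Q r) - Phi D - P.Delta D := by
    abel
  rw [starValue, relaxValue, hobj]
  exact optValue_mono _ hsub

/-- With x_i² ≤ X_ii the upper diagonal constraint gives (x_i - l_i)(x_i - u_i) ≤ 0. -/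
theorem mem_box_of_sdpFeasible (hlu : P.l ≤ P.u) {z : (Fin n → ℝ) × Matrix (Fin n) (Fin n) ℝ}
    (hz : z ∈ P.sdpFeasible) (i : Fin n) : P.l i ≤ z.1 i ∧ z.1 i ≤ P.u i := by
  obtain ⟨-, h1, -, -, -, hb, -⟩ := hz
  have h2 := h1 i
  have h3 := sq_le_diag_of_bordered hb i
  have h4 := hlu i
  constructor <;> nlinarith

/-- Every convex relaxation `(P')` lies below `(SDP)`. -/
theorem relaxValue_le_sdpValue (hlu : P.l ≤ P.u) {S₀ : Matrix (Fin n) (Fin n) ℝ}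
    {S : Fin m → Matrix (Fin n) (Fin n) ℝ} (hS : OptFeasible S₀ S) :
    P.relaxValue S₀ S ≤ P.sdpValue := by
  refine le_iInf₂ fun z hz => ?_
  have hbox := P.mem_box_of_sdpFeasible hlu hz
  obtain ⟨x, X⟩ := z
  obtain ⟨hq, h1, h2, h3, hsymm, hb, hmc, htri⟩ := hz
  have key : ∀ T : Matrix (Fin n) (Fin n) ℝ, T.PosSemidef →
      frob T (vecMulVec x x) ≤ frob T X := fun T hT => by
    have := frob_nonneg hT (posSemidef_sub_of_bordered hb)
    rw [frob_sub_right] at this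
    linarith
  have hmem : (x, X) ∈ P.relaxFeasible S := by
    refine ⟨hbox, fun r => ?_, fun i j hij => ?_, htri, fun i j _ => hsymm.apply i j⟩
    · have := key _ (hS.2 r)
      have := hq r
      simp only [frob_sub_left] at *
      linarith
    · rcases hij.lt_or_eq with hij | rfl
      · exact hmc i j hij
      · exact (P.mc_diag_le_zero_iff i x X).2 ⟨h1 i, h2 i, h3 i⟩
  refine (iInf₂_le (x, X) hmem).trans ?_
  rw [EReal.coe_le_coe_iff]
  have := key _ hS.1
  simp only [frob_sub_left]
  linarith

end QCQP

/-! ### Separation and extension of affine inequalities. -/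

/-- A theorem of the alternative: if a system of affine inequalities is solvable on a compact convex
set and `f` is positive on its solutions, then nonnegative multipliers show it. -/
theorem exists_multipliers {E ι : Type*} [AddCommGroup E] [Module ℝ E] [TopologicalSpace E]
    [Fintype ι] {B : Set E} (hB : IsCompact B) (hBc : Convex ℝ B) {f : E → ℝ} {g : ι → E → ℝ}
    (hf : ContinuousOn f B) (hg : ∀ i, ContinuousOn (g i) B)
    (hf_aff : ∀ z ∈ B, ∀ w ∈ B, ∀ a b : ℝ, a + b = 1 → f (a • z + b • w) = a * f z + b * f w)
    (hg_aff : ∀ i, ∀ z ∈ B, ∀ w ∈ B, ∀ a b : ℝ, a + b = 1 →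
      g i (a • z + b • w) = a * g i z + b * g i w)
    (hne : ∃ z ∈ B, ∀ i, g i z ≤ 0) (hpos : ∀ z ∈ B, (∀ i, g i z ≤ 0) → 0 < f z) :
    ∃ c : ι → ℝ, (∀ i, 0 ≤ c i) ∧ ∀ z ∈ B, 0 ≤ f z + ∑ i, c i * g i z := by
  classical
  let F : E → ℝ × (ι → ℝ) := fun z => (f z, fun i => g i z)
  have hF : ContinuousOn F B := hf.prodMk (continuousOn_pi.2 hg)
  have hFc : Convex ℝ (F '' B) := by
    rintro _ ⟨z, hz, rfl⟩ _ ⟨w, hw, rfl⟩ a b ha hb hab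
    refine ⟨a • z + b • w, hBc hz hw ha hb hab, ?_⟩
    ext i
    · simp [F, hf_aff z hz w hw a b hab]
    · simp [F, hg_aff i z hz w hw a b hab]
  have hdisj : Disjoint (F '' B) (Set.Iic 0) := by
    rw [Set.disjoint_left]
    rintro _ ⟨z, hz, rfl⟩ hle
    exact absurd hle.1 (not_le.2 (hpos z hz fun i => hle.2 i))
  -- The image of B is compact and convex and misses the closed nonpositive orthant: a common point
  -- would be a solution with f ≤ 0.
  obtain ⟨L, a, b, hL1, hab, hL2⟩ :=
    geometric_hahn_banach_compact_closed hFc (hB.image_of_continuousOn hF) (convex_Iic 0)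
      isClosed_Iic hdisj
  have hb0 : b < 0 := by simpa using hL2 0 (by simp)
  have hcone : ∀ y : ℝ × (ι → ℝ), y ≤ 0 → 0 ≤ L y := by
    intro y hy
    by_contra hneg
    push Not at hneg
    -- If L y < 0, this multiple of y stays in the orthant and has L-value exactly b, against the
    -- strict bound.
    have h := hL2 ((b / L y) • y) (smul_nonpos_of_nonneg_of_nonpos
      (div_nonneg_of_nonpos hb0.le hneg.le) hy)
    rw [map_smul, smul_eq_mul, div_mul_cancel₀ _ hneg.ne] at h
    exact lt_irrefl _ h
  let c0 : ℝ := -L (1, 0)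
  let c : ι → ℝ := fun i => -L (0, Pi.single i 1)
  have hc0 : 0 ≤ c0 := by
    have := hcone (-(1, 0)) (by
      rw [Left.neg_nonpos_iff]
      exact ⟨zero_le_one, le_rfl⟩)
    rwa [map_neg] at this
  have hc : ∀ i, 0 ≤ c i := fun i => by
    have := hcone (-(0, Pi.single i 1)) (by
      rw [Left.neg_nonpos_iff]
      exact ⟨le_rfl, Pi.single_nonneg.2 zero_le_one⟩)
    rwa [map_neg] at this
  have hL : ∀ y : ℝ × (ι → ℝ), L y = -(c0 * y.1 + ∑ i, c i * y.2 i) := by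
    intro y
    have hy : y = y.1 • ((1, 0) : ℝ × (ι → ℝ))
        + ∑ i, y.2 i • ((0, Pi.single i 1) : ℝ × (ι → ℝ)) := by
      ext i
      · simp [Prod.fst_sum]
      · simp [Prod.snd_sum, Finset.sum_apply, Pi.single_apply]
    conv_lhs => rw [hy]
    rw [map_add, map_sum, map_smul, neg_add, ← Finset.sum_neg_distrib]
    simp only [map_smul, smul_eq_mul, c0, c]
    congr 1
    · ring
    · exact Finset.sum_congr rfl fun i _ => by ring
  have hmain : ∀ z ∈ B, 0 < c0 * f z + ∑ i, c i * g i z := fun z hz => by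
    have := hL1 (F z) ⟨z, hz, rfl⟩
    rw [hL] at this
    change -(c0 * f z + ∑ i, c i * g i z) < a at this
    linarith
  -- If c0 were 0, the combination of the constraints would be positive at a solution of the system.
  -- This is the only use of solvability.
  have hc0' : 0 < c0 := by
    refine lt_of_le_of_ne hc0 fun h => ?_
    obtain ⟨z, hz, hgz⟩ := hne
    have h1 := hmain z hz
    have h2 : ∑ i, c i * g i z ≤ 0 :=
      Finset.sum_nonpos fun i _ => mul_nonpos_of_nonneg_of_nonpos (hc i) (hgz i)
    rw [← h] at h1
    linarith
  refine ⟨fun i => c i / c0, fun i => div_nonneg (hc i) hc0, fun z hz => ?_⟩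
  have h : f z + ∑ i, c i / c0 * g i z = (c0 * f z + ∑ i, c i * g i z) / c0 := by
    rw [add_div, mul_div_cancel_left₀ _ hc0'.ne', Finset.sum_div]
    congr 1
    exact Finset.sum_congr rfl fun i _ => by ring
  rw [h]
  exact (div_pos (hmain z hz) hc0').le

/-- An affine function that is nonnegative where `h ≤ R` decreases at most linearly in `h`. -/
theorem nonneg_add_mul_of_nonneg_of_le {E : Type*} [AddCommGroup E] [Module ℝ E] {C : Set E}
    (hC : Convex ℝ C) {q h : E → ℝ} {R c : ℝ} (hR : 0 < R)
    (hq_aff : ∀ z ∈ C, ∀ w ∈ C, ∀ a b : ℝ, a + b = 1 → q (a • z + b • w) = a * q z + b * q w)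
    (hh_aff : ∀ z ∈ C, ∀ w ∈ C, ∀ a b : ℝ, a + b = 1 → h (a • z + b • w) = a * h z + b * h w)
    {z₀ : E} (hz₀ : z₀ ∈ C) (hh₀ : h z₀ ≤ 0) (hc : q z₀ ≤ c)
    (hq : ∀ z ∈ C, h z ≤ R → 0 ≤ q z) {z : E} (hz : z ∈ C) (hhz : R < h z) :
    0 ≤ q z + c / R * h z := by
  have hq₀ : 0 ≤ q z₀ := hq z₀ hz₀ (hh₀.trans hR.le)
  -- The point of the segment from z₀ to z at which h = R; there q is still known to be nonnegative.
  set θ : ℝ := (R - h z₀) / (h z - h z₀) with hθ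
  have hd : 0 < h z - h z₀ := by linarith
  have hθ0 : 0 < θ := div_pos (by linarith) hd
  have hθ1 : θ ≤ 1 := (div_le_one hd).2 (by linarith)
  have hθd : θ * (h z - h z₀) = R - h z₀ := div_mul_cancel₀ _ hd.ne'
  have hsum : θ + (1 - θ) = 1 := by ring
  have h1 : h (θ • z + (1 - θ) • z₀) = R := by
    rw [hh_aff z hz z₀ hz₀ _ _ hsum]
    linarith
  have h2 := hq _ (hC hz hz₀ hθ0.le (sub_nonneg.2 hθ1) hsum) h1.le
  rw [hq_aff z hz z₀ hz₀ _ _ hsum] at h2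
  have h3 : (1 - θ) * R ≤ θ * h z := by nlinarith
  have h4 : (1 - θ) * q z₀ ≤ θ * (c / R * h z) := by
    calc (1 - θ) * q z₀ ≤ (1 - θ) * c := mul_le_mul_of_nonneg_left hc (sub_nonneg.2 hθ1)
      _ = (1 - θ) * R * (c / R) := by field_simp
      _ ≤ θ * h z * (c / R) := mul_le_mul_of_nonneg_right h3 (div_nonneg (hq₀.trans hc) hR.le)
      _ = θ * (c / R * h z) := by ring
  have h5 : 0 ≤ θ * (q z + c / R * h z) := by linarith
  exact nonneg_of_mul_nonneg_right h5 hθ0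

/-! ### The semidefinite set and its compact slices. -/

namespace QCQP

variable {n m : ℕ} (P : QCQP n m)

/-- The pairs `(x, X)` that satisfy the semidefinite constraint of `(SDP)`. -/
def psdSet (n : ℕ) : Set ((Fin n → ℝ) × Matrix (Fin n) (Fin n) ℝ) :=
  {z | (bordered 1 z.1 z.2).PosSemidef}

/-- A function of `(x, X)` that is affine where `X` is symmetric. -/
def IsAffineOnSymm (g : (Fin n → ℝ) × Matrix (Fin n) (Fin n) ℝ → ℝ) : Prop :=
  ∃ (M : Matrix (Fin n) (Fin n) ℝ) (v : Fin n → ℝ) (a : ℝ),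
    ∀ z : (Fin n → ℝ) × Matrix (Fin n) (Fin n) ℝ, z.2.IsSymm → g z = frob M z.2 + v ⬝ᵥ z.1 + a

theorem isSymm_of_mem_psdSet {z : (Fin n → ℝ) × Matrix (Fin n) (Fin n) ℝ}
    (hz : z ∈ psdSet n) : z.2.IsSymm :=
  ((bordered_posSemidef_iff _ _ _).1 hz).1

theorem convex_psdSet : Convex ℝ (psdSet n) := by
  intro z hz w hw a b ha hb hab
  simp only [psdSet, Set.mem_ofPred_eq, bordered_posSemidef_iff] at hz hw ⊢
  refine ⟨(hz.1.smul a).add (hw.1.smul b), fun t y => ?_⟩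
  have h1 := mul_nonneg ha (hz.2 t y)
  have h2 := mul_nonneg hb (hw.2 t y)
  simp only [Prod.fst_add, Prod.snd_add, Prod.smul_fst, Prod.smul_snd, frob_add, frob_smul,
    add_dotProduct, smul_dotProduct, smul_eq_mul]
  obtain rfl : b = 1 - a := by linarith
  linarith

theorem continuous_frob (M : Matrix (Fin n) (Fin n) ℝ) :
    Continuous fun X : Matrix (Fin n) (Fin n) ℝ => frob M X := by
  unfold frob
  fun_prop

theorem continuous_dotProduct_const (v : Fin n → ℝ) : Continuous fun x : Fin n → ℝ => v ⬝ᵥ x := by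
  unfold dotProduct
  fun_prop

theorem isClosed_psdSet : IsClosed (psdSet n) := by
  have h : psdSet n = {z | z.2ᵀ = z.2} ∩ ⋂ (t : ℝ) (y : Fin n → ℝ),
      {z | 0 ≤ 1 * t ^ 2 + 2 * t * (y ⬝ᵥ z.1) + frob (vecMulVec y y) z.2} := by
    ext z
    simp only [psdSet, Set.mem_ofPred_eq, bordered_posSemidef_iff, Set.mem_inter_iff,
      Set.mem_iInter, dotProduct_comm z.1, frob_comm z.2, Matrix.IsSymm]
  rw [h]
  refine (isClosed_eq (by fun_prop) (by fun_prop)).inter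
    (isClosed_iInter fun t => isClosed_iInter fun y => isClosed_le continuous_const ?_)
  have h1 := (continuous_dotProduct_const y).comp
    (continuous_fst (X := Fin n → ℝ) (Y := Matrix (Fin n) (Fin n) ℝ))
  have h2 := (continuous_frob (vecMulVec y y)).comp
    (continuous_snd (X := Fin n → ℝ) (Y := Matrix (Fin n) (Fin n) ℝ))
  exact (continuous_const.add (continuous_const.mul h1)).add h2

namespace IsAffineOnSymm

variable {g h : (Fin n → ℝ) × Matrix (Fin n) (Fin n) ℝ → ℝ}

theorem map_combo (hg : IsAffineOnSymm g) (z : (Fin n → ℝ) × Matrix (Fin n) (Fin n) ℝ)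
    (hz : z ∈ psdSet n) (w : (Fin n → ℝ) × Matrix (Fin n) (Fin n) ℝ) (hw : w ∈ psdSet n)
    (a b : ℝ) (hab : a + b = 1) : g (a • z + b • w) = a * g z + b * g w := by
  obtain ⟨M, v, k, hg⟩ := hg
  have hz' := isSymm_of_mem_psdSet hz
  have hw' := isSymm_of_mem_psdSet hw
  rw [hg z hz', hg w hw', hg _ ((hz'.smul a).add (hw'.smul b))]
  simp only [Prod.fst_add, Prod.snd_add, Prod.smul_fst, Prod.smul_snd, frob_add_right,
    frob_smul_right, dotProduct_add, dotProduct_smul, smul_eq_mul]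
  obtain rfl : b = 1 - a := by linarith
  ring

theorem continuousOn (hg : IsAffineOnSymm g) : ContinuousOn g (psdSet n) := by
  obtain ⟨M, v, k, hg⟩ := hg
  have h1 := (continuous_dotProduct_const v).comp
    (continuous_fst (X := Fin n → ℝ) (Y := Matrix (Fin n) (Fin n) ℝ))
  have h2 := (continuous_frob M).comp
    (continuous_snd (X := Fin n → ℝ) (Y := Matrix (Fin n) (Fin n) ℝ))
  exact ((h2.add h1).add continuous_const).continuousOn.congr
    fun z hz => hg z (isSymm_of_mem_psdSet hz)

theorem zero : IsAffineOnSymm fun _ : (Fin n → ℝ) × Matrix (Fin n) (Fin n) ℝ => (0 : ℝ) :=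
  ⟨0, 0, 0, fun z _ => by simp [frob_zero_left]⟩

theorem add (hg : IsAffineOnSymm g) (hh : IsAffineOnSymm h) :
    IsAffineOnSymm fun z => g z + h z := by
  obtain ⟨M, v, k, hg⟩ := hg
  obtain ⟨M', v', k', hh⟩ := hh
  refine ⟨M + M', v + v', k + k', fun z hz => ?_⟩
  simp only [hg z hz, hh z hz, frob_add, add_dotProduct]
  ring

theorem const_mul (hg : IsAffineOnSymm g) (c : ℝ) : IsAffineOnSymm fun z => c * g z := by
  obtain ⟨M, v, k, hg⟩ := hg
  refine ⟨c • M, c • v, c * k, fun z hz => ?_⟩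
  simp only [hg z hz, frob_smul, smul_dotProduct, smul_eq_mul]
  ring

theorem sum {ι : Type*} (s : Finset ι) {g : ι → (Fin n → ℝ) × Matrix (Fin n) (Fin n) ℝ → ℝ}
    (hg : ∀ i ∈ s, IsAffineOnSymm (g i)) : IsAffineOnSymm fun z => ∑ i ∈ s, g i z := by
  classical
  induction s using Finset.induction_on with
  | empty => simpa using zero
  | insert a s ha ih =>
    simp only [Finset.sum_insert ha]
    exact (hg a (by simp)).add (ih fun i hi => hg i (by simp [hi]))

/-- An expression in `X i i` and `x i`. -/
theorem diag (i : Fin n) (a b c : ℝ) :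
    IsAffineOnSymm fun z : (Fin n → ℝ) × Matrix (Fin n) (Fin n) ℝ =>
      a * z.2 i i + b * z.1 i + c :=
  ⟨a • Matrix.single i i 1, Pi.single i b, c, fun z _ => by
    rw [frob_smul, frob_single, single_dotProduct]⟩

end IsAffineOnSymm

/-- The sum of the upper constraints on the diagonal of `X`. -/
def diagSum (z : (Fin n → ℝ) × Matrix (Fin n) (Fin n) ℝ) : ℝ :=
  ∑ i, (z.2 i i - P.u i * z.1 i - P.l i * z.1 i + P.u i * P.l i)

theorem isAffineOnSymm_diagSum : IsAffineOnSymm P.diagSum :=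
  IsAffineOnSymm.sum _ fun i _ => by
    have := IsAffineOnSymm.diag i 1 (-P.u i - P.l i) (P.u i * P.l i)
    convert this using 2
    ring

theorem neg_sum_sq_le_diagSum {z : (Fin n → ℝ) × Matrix (Fin n) (Fin n) ℝ}
    (hz : z ∈ psdSet n) : -(∑ i, (P.u i - P.l i) ^ 2) ≤ P.diagSum z := by
  rw [← Finset.sum_neg_distrib]
  refine Finset.sum_le_sum fun i _ => ?_
  have := sq_le_diag_of_bordered hz i
  -- Since X_ii ≥ x_i², the term is at least (x_i - u_i)(x_i - l_i) ≥ -(u_i - l_i)²/4.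
  nlinarith [sq_nonneg (2 * z.1 i - P.u i - P.l i), sq_nonneg (P.u i - P.l i)]

theorem isCompact_psdSet_inter_diagSum_le (R : ℝ) :
    IsCompact (psdSet n ∩ {z | P.diagSum z ≤ R}) := by
  set K : ℝ := 2 * R + ∑ i, (P.u i ^ 2 + P.l i ^ 2) with hK
  have hbox : IsCompact ((Set.univ.pi fun _ => Set.Icc (-(K + 1)) (K + 1)) ×ˢ
      (Set.univ.pi fun _ => Set.univ.pi fun _ => Set.Icc (-K) K) :
      Set ((Fin n → ℝ) × Matrix (Fin n) (Fin n) ℝ)) :=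
    (isCompact_univ_pi fun _ => isCompact_Icc).prod
      (isCompact_univ_pi fun _ => isCompact_univ_pi fun _ => isCompact_Icc)
  refine hbox.of_isClosed_subset ?_ ?_
  · exact P.isAffineOnSymm_diagSum.continuousOn.preimage_isClosed_of_isClosed isClosed_psdSet
      isClosed_Iic
  · rintro z ⟨hz, hR⟩
    have hpsd := posSemidef_of_bordered hz
    have hdiag : ∀ i, z.2 i i ≤ K := by
      intro i
      have h1 : z.2 i i ≤ ∑ j, z.2 j j :=
        Finset.single_le_sum (f := fun j => z.2 j j) (fun j _ => hpsd.diag_nonneg)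
          (Finset.mem_univ i)
      -- Termwise, the difference of the two sides is at least (x_j - u_j - l_j)², which is where
      -- `K` comes from.
      have h2 : ∑ j, z.2 j j ≤ 2 * P.diagSum z + ∑ j, (P.u j ^ 2 + P.l j ^ 2) := by
        simp only [diagSum]
        rw [Finset.mul_sum, ← Finset.sum_add_distrib]
        refine Finset.sum_le_sum fun j _ => ?_
        have := sq_le_diag_of_bordered hz j
        nlinarith [sq_nonneg (z.1 j - P.u j - P.l j)]
      have h3 : P.diagSum z ≤ R := hR
      linarith
    refine ⟨fun i _ => ?_, fun i _ j _ => ?_⟩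
    · have h1 := sq_le_diag_of_bordered hz i
      have h2 := hdiag i
      constructor <;> nlinarith [sq_nonneg (z.1 i - 1), sq_nonneg (z.1 i + 1)]
    · have h1 := two_mul_abs_le_of_posSemidef hpsd i j
      have h2 := hdiag i
      have h3 := hdiag j
      exact abs_le.1 (by linarith)

end QCQP

/-! ### Strong duality between (SDP) and (D). -/

namespace QCQP

variable {n m : ℕ} (P : QCQP n m)

theorem isAffineOnSymm_mc (i j : Fin n) (t : Fin 4) :
    IsAffineOnSymm fun z => P.mc i j z.1 z.2 t :=
  ⟨_, _, _, fun z hz => P.mc_eq i j t z.1 hz⟩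

theorem isAffineOnSymm_tri (i j k : Fin n) (t : Fin 12) :
    IsAffineOnSymm fun z => P.tri i j k z.1 z.2 t :=
  ⟨_, _, _, fun z hz => P.tri_eq i j k t z.1 hz⟩

/-- The index set of the affine constraints of `(SDP)`. -/
abbrev ConstraintIndex (n m : ℕ) : Type :=
  Fin m ⊕ Fin n ⊕ Fin n ⊕ Fin n ⊕ (Fin n × Fin n × Fin 4) ⊕ (Fin n × Fin n × Fin n × Fin 12)

/-- The affine constraint functions of `(SDP)`; indices out of order give the zero function. -/
def constraint : ConstraintIndex n m → (Fin n → ℝ) × Matrix (Fin n) (Fin n) ℝ → ℝ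
  | .inl r, z => frob (P.Q r) z.2 + P.c r ⬝ᵥ z.1 - P.b r
  | .inr (.inl i), z => z.2 i i - P.u i * z.1 i - P.l i * z.1 i + P.u i * P.l i
  | .inr (.inr (.inl i)), z => -z.2 i i + 2 * P.u i * z.1 i - P.u i ^ 2
  | .inr (.inr (.inr (.inl i))), z => -z.2 i i + 2 * P.l i * z.1 i - P.l i ^ 2
  | .inr (.inr (.inr (.inr (.inl (i, j, t))))), z => if i < j then P.mc i j z.1 z.2 t else 0
  | .inr (.inr (.inr (.inr (.inr (i, j, k, t))))), z =>
      if i < j ∧ j < k then P.tri i j k z.1 z.2 t else 0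

theorem isAffineOnSymm_constraint (a : ConstraintIndex n m) : IsAffineOnSymm (P.constraint a) := by
  rcases a with r | i | i | i | ⟨i, j, t⟩ | ⟨i, j, k, t⟩
  · exact ⟨P.Q r, P.c r, -P.b r, fun z _ => sub_eq_add_neg _ _⟩
  · convert IsAffineOnSymm.diag i 1 (-P.u i - P.l i) (P.u i * P.l i) using 2
    simp only [constraint]
    ring
  · convert IsAffineOnSymm.diag i (-1) (2 * P.u i) (-P.u i ^ 2) using 2
    simp only [constraint]
    ring
  · convert IsAffineOnSymm.diag i (-1) (2 * P.l i) (-P.l i ^ 2) using 2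
    simp only [constraint]
    ring
  · by_cases h : i < j
    · convert P.isAffineOnSymm_mc i j t using 2
      simp [constraint, h]
    · convert IsAffineOnSymm.zero using 2
      simp [constraint, h]
  · by_cases h : i < j ∧ j < k
    · convert P.isAffineOnSymm_tri i j k t using 2
      simp [constraint, h]
    · convert IsAffineOnSymm.zero using 2
      simp [constraint, h]

theorem mem_sdpFeasible_iff (z : (Fin n → ℝ) × Matrix (Fin n) (Fin n) ℝ) :
    z ∈ P.sdpFeasible ↔ z ∈ psdSet n ∧ ∀ a, P.constraint a z ≤ 0 := by
  constructor
  · rintro ⟨hq, h1, h2, h3, -, hb, hmc, htri⟩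
    refine ⟨hb, ?_⟩
    rintro (r | i | i | i | ⟨i, j, t⟩ | ⟨i, j, k, t⟩)
    · exact sub_nonpos.2 (hq r)
    · exact h1 i
    · exact h2 i
    · exact h3 i
    · simp only [constraint]
      split_ifs with h
      exacts [hmc i j h t, le_rfl]
    · simp only [constraint]
      split_ifs with h
      exacts [htri i j k h.1 h.2 t, le_rfl]
  · rintro ⟨hb, h⟩
    refine ⟨fun r => sub_nonpos.1 (h (.inl r)), fun i => h (.inr (.inl i)),
      fun i => h (.inr (.inr (.inl i))), fun i => h (.inr (.inr (.inr (.inl i)))),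
      isSymm_of_mem_psdSet hb, hb, fun i j hij t => ?_, fun i j k hij hjk t => ?_⟩
    · have := h (.inr (.inr (.inr (.inr (.inl (i, j, t))))))
      simpa [constraint, hij] using this
    · have := h (.inr (.inr (.inr (.inr (.inr (i, j, k, t))))))
      simpa [constraint, hij, hjk] using this

/-- The dual variables with given multipliers for the affine constraints. -/
def DualVars.ofMultipliers (c : ConstraintIndex n m → ℝ) (s ρ : ℝ) : DualVars n m where
  α r := c (.inl r)
  φ i j t := c (.inr (.inr (.inr (.inr (.inl (i, j, t))))))
  φ₁ i := c (.inr (.inl i)) + s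
  φ₂ i := c (.inr (.inr (.inl i)))
  φ₃ i := c (.inr (.inr (.inr (.inl i))))
  δ i j k t := c (.inr (.inr (.inr (.inr (.inr (i, j, k, t))))))
  ρ := ρ

theorem lagrangian_ofMultipliers (c : ConstraintIndex n m → ℝ) (s ρ : ℝ)
    (z : (Fin n → ℝ) × Matrix (Fin n) (Fin n) ℝ) :
    P.lagrangian (DualVars.ofMultipliers c s ρ) z.1 z.2
      = frob P.Q₀ z.2 + P.c₀ ⬝ᵥ z.1 + ∑ a, c a * P.constraint a z + s * P.diagSum z := by
  have hmc : ∀ F : Fin n → Fin n → Fin 4 → ℝ,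
      ∑ i, ∑ j, ∑ t, c (.inr (.inr (.inr (.inr (.inl (i, j, t)))))) *
          (if i < j then F i j t else 0)
        = ∑ i, ∑ j ∈ Finset.Ioi i, ∑ t,
          c (.inr (.inr (.inr (.inr (.inl (i, j, t)))))) * F i j t := by
    intro F
    refine Finset.sum_congr rfl fun i _ => ?_
    rw [← Finset.filter_lt_eq_Ioi, Finset.sum_filter]
    refine Finset.sum_congr rfl fun j _ => ?_
    split_ifs <;> simp
  have htri : ∀ F : Fin n → Fin n → Fin n → Fin 12 → ℝ,
      ∑ i, ∑ j, ∑ k, ∑ t, c (.inr (.inr (.inr (.inr (.inr (i, j, k, t)))))) *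
          (if i < j ∧ j < k then F i j k t else 0)
        = ∑ i, ∑ j ∈ Finset.Ioi i, ∑ k ∈ Finset.Ioi j, ∑ t,
          c (.inr (.inr (.inr (.inr (.inr (i, j, k, t)))))) * F i j k t := by
    intro F
    refine Finset.sum_congr rfl fun i _ => ?_
    rw [← Finset.filter_lt_eq_Ioi, Finset.sum_filter]
    refine Finset.sum_congr rfl fun j _ => ?_
    split_ifs with hij
    · rw [← Finset.filter_lt_eq_Ioi, Finset.sum_filter]
      refine Finset.sum_congr rfl fun k _ => ?_
      by_cases hjk : j < k <;> simp [hij, hjk]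
    · simp [hij]
  have hd : ∑ i, s * (z.2 i i - P.u i * z.1 i - P.l i * z.1 i + P.u i * P.l i)
      = s * P.diagSum z := by
    simp only [diagSum]
    rw [Finset.mul_sum]
  simp only [Fintype.sum_sum_type, Fintype.sum_prod_type, constraint, lagrangian,
    DualVars.ofMultipliers, hmc, htri, add_mul, Finset.sum_add_distrib, hd]
  ring

theorem Phi_isSymm (D : DualVars n m) : (Phi D).IsSymm := by
  have h : ∀ (i j : Fin n) (t : Fin 4), (mcM i j t).IsSymm := fun i j t => by
    have := symE_isSymm i j
    fin_cases t <;> simp [mcM, Matrix.IsSymm, this.eq]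
  simp only [Phi, Matrix.IsSymm, transpose_add, transpose_sum, transpose_smul, (h _ _ _).eq,
    diagonal_transpose]

theorem Delta_isSymm (D : DualVars n m) : (P.Delta D).IsSymm := by
  simp only [Delta, triM, Matrix.IsSymm, transpose_add, transpose_sum, transpose_smul,
    (symE_isSymm _ _).eq]

theorem dualS_isSymm (D : DualVars n m) : (P.dualS D).IsSymm := by
  simp only [dualS, Matrix.IsSymm, transpose_add, transpose_sum, transpose_smul, P.symm_Q₀.eq,
    (P.symm_Q _).eq, (Phi_isSymm D).eq, (P.Delta_isSymm D).eq]

/-- An affine function that is nonnegative on `psdSet` has a positive semidefinite matrix. -/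
theorem bordered_posSemidef_of_nonneg {M : Matrix (Fin n) (Fin n) ℝ} (hM : M.IsSymm)
    {v : Fin n → ℝ} {ρ : ℝ} (h : ∀ z ∈ psdSet n, 0 ≤ frob M z.2 + v ⬝ᵥ z.1 + ρ) :
    (bordered ρ ((1 / 2 : ℝ) • v) M).PosSemidef := by
  refine (bordered_posSemidef_iff _ _ _).2 ⟨hM, fun t y => ?_⟩
  rw [smul_dotProduct, smul_eq_mul]
  rcases eq_or_ne t 0 with rfl | ht
  -- The case t = 0 uses recession directions: the points (0, k yyᵀ) stay in `psdSet` for all k ≥ 0.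
  · have key : ∀ k : ℝ, 0 ≤ k → 0 ≤ k * frob M (vecMulVec y y) + ρ := by
      intro k hk
      have hmem : ((0, k • vecMulVec y y) : (Fin n → ℝ) × Matrix (Fin n) (Fin n) ℝ) ∈
          psdSet n := by
        refine (bordered_posSemidef_iff _ _ _).2 ⟨(vecMulVec_self_isSymm y).smul k,
          fun t w => ?_⟩
        have h1 := ((bordered_posSemidef_iff _ _ _).1 (bordered_one_posSemidef_vecMulVec y)).2 0 w
        simp only [zero_dotProduct, frob_smul] at h1 ⊢
        nlinarith [mul_nonneg hk h1, sq_nonneg t]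
      simpa [frob_smul_right] using h _ hmem
    by_contra hneg
    have hneg' : frob M (vecMulVec y y) < 0 := by
      push Not at hneg
      linarith
    have h0 := key 0 le_rfl
    -- This k would make the expression equal to -1.
    have h1 := key ((ρ + 1) / -frob M (vecMulVec y y))
      (div_nonneg (by linarith) (by linarith))
    have h2 : (ρ + 1) / -frob M (vecMulVec y y) * frob M (vecMulVec y y) = -(ρ + 1) := by
      rw [div_neg, neg_mul, div_mul_cancel₀ _ hneg'.ne]
    linarith
  · have h1 := h (t⁻¹ • y, vecMulVec (t⁻¹ • y) (t⁻¹ • y)) (bordered_one_posSemidef_vecMulVec _)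
    simp only [smul_vecMulVec, vecMulVec_smul, frob_smul_right, dotProduct_smul,
      smul_eq_mul] at h1
    have h2 := mul_nonneg (sq_nonneg t) h1
    have h3 : t ^ 2 * (t⁻¹ * (t⁻¹ * frob M (vecMulVec y y)) + t⁻¹ * v ⬝ᵥ y + ρ)
        = ρ * t ^ 2 + 2 * t * (1 / 2 * v ⬝ᵥ y) + frob M (vecMulVec y y) := by
      field_simp
      ring
    linarith

theorem dualObj_ofMultipliers (c : ConstraintIndex n m → ℝ) (s ρ : ℝ) :
    P.dualObj (DualVars.ofMultipliers c s ρ)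
      = P.dualObj (DualVars.ofMultipliers c s 0) - ρ := by
  simp [dualObj, DualVars.ofMultipliers]

/-- The term in `diagSum` only raises every φ¹_i by s, and ρ is chosen so that the dual objective is
v. -/
theorem exists_dualFeasible_of_le_lagrangian {c : ConstraintIndex n m → ℝ} (hc : ∀ a, 0 ≤ c a)
    {s v : ℝ} (hs : 0 ≤ s)
    (h : ∀ z ∈ psdSet n,
      v ≤ frob P.Q₀ z.2 + P.c₀ ⬝ᵥ z.1 + ∑ a, c a * P.constraint a z + s * P.diagSum z) :
    ∃ D, P.DualFeasible D ∧ P.dualObj D = v := by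
  set ρ : ℝ := P.dualObj (DualVars.ofMultipliers c s 0) - v with hρ
  have hobj : P.dualObj (DualVars.ofMultipliers c s ρ) = v := by
    rw [dualObj_ofMultipliers, hρ]
    ring
  refine ⟨DualVars.ofMultipliers c s ρ, ⟨fun r => hc _, fun i j _ t => hc _,
    fun i => add_nonneg (hc _) hs, fun i => hc _, fun i => hc _, fun i j k _ _ t => hc _,
    bordered_posSemidef_of_nonneg (P.dualS_isSymm _) fun z hz => ?_⟩, hobj⟩
  have h1 := h z hz
  rw [← P.lagrangian_ofMultipliers c s ρ, P.lagrangian_eq _ _ (isSymm_of_mem_psdSet hz),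
    hobj] at h1
  linarith

/-- At Y = xxᵀ each -h is a product of two bound slacks, and each -h' is a sum of two triple
products whose cubic terms cancel. One triple product has a factor x_i, x_j or x_k, nonnegative
because l ≥ 0. -/
theorem mem_sdpFeasible_of_mem_feasibleSet (hl : ∀ i, 0 ≤ P.l i) {x : Fin n → ℝ}
    (hx : x ∈ P.feasibleSet) : (x, vecMulVec x x) ∈ P.sdpFeasible := by
  obtain ⟨hq, hb⟩ := hx
  refine ⟨hq, fun i => ?_, fun i => ?_, fun i => ?_, vecMulVec_self_isSymm x,
    bordered_one_posSemidef_vecMulVec x, fun i j hij t => ?_, fun i j k hij hjk t => ?_⟩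
  · simp only [vecMulVec_apply]
    nlinarith [mul_nonneg (sub_nonneg.2 (hb i).1) (sub_nonneg.2 (hb i).2)]
  · simp only [vecMulVec_apply]
    nlinarith [sq_nonneg (x i - P.u i)]
  · simp only [vecMulVec_apply]
    nlinarith [sq_nonneg (x i - P.l i)]
  · have a1 := sub_nonneg.2 (hb i).1
    have a2 := sub_nonneg.2 (hb i).2
    have b1 := sub_nonneg.2 (hb j).1
    have b2 := sub_nonneg.2 (hb j).2
    fin_cases t <;> simp [mc, vecMulVec_apply] <;>
      nlinarith [mul_nonneg a1 b1, mul_nonneg a1 b2, mul_nonneg a2 b1, mul_nonneg a2 b2]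
  · have a1 := sub_nonneg.2 (hb i).1
    have a2 := sub_nonneg.2 (hb i).2
    have b1 := sub_nonneg.2 (hb j).1
    have b2 := sub_nonneg.2 (hb j).2
    have c1 := sub_nonneg.2 (hb k).1
    have c2 := sub_nonneg.2 (hb k).2
    have a0 := (hl i).trans (hb i).1
    have b0 := (hl j).trans (hb j).1
    have c0 := (hl k).trans (hb k).1
    have mul₃ : ∀ {p q r : ℝ}, 0 ≤ p → 0 ≤ q → 0 ≤ r → 0 ≤ p * q * r :=
      fun hp hq hr => mul_nonneg (mul_nonneg hp hq) hr
    fin_cases t <;> simp [tri, vecMulVec_apply]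
    · linarith [mul₃ a2 b2 c2, mul₃ a0 b1 c1]
    · linarith [mul₃ a2 b2 c2, mul₃ a1 b0 c1]
    · linarith [mul₃ a2 b2 c2, mul₃ a1 b1 c0]
    · linarith [mul₃ a2 b2 c1, mul₃ a0 b1 c2]
    · linarith [mul₃ a2 b2 c1, mul₃ a1 b0 c2]
    · linarith [mul₃ a2 b1 c2, mul₃ a0 b2 c1]
    · linarith [mul₃ a2 b1 c2, mul₃ a1 b2 c0]
    · linarith [mul₃ a1 b2 c2, mul₃ a2 b0 c1]
    · linarith [mul₃ a1 b2 c2, mul₃ a2 b1 c0]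
    · linarith [mul₃ a2 b1 c1, mul₃ a0 b2 c2]
    · linarith [mul₃ a1 b2 c1, mul₃ a2 b0 c2]
    · linarith [mul₃ a1 b1 c2, mul₃ a2 b2 c0]

/-- Strong duality between `(SDP)` and `(D)`. -/
theorem exists_dualFeasible_of_lt (hl : ∀ i, 0 ≤ P.l i) (hP : P.feasibleSet.Nonempty) {v v' : ℝ}
    (hv : v < v') (h : ∀ z ∈ P.sdpFeasible, v' < frob P.Q₀ z.2 + P.c₀ ⬝ᵥ z.1) :
    ∃ D, P.DualFeasible D ∧ P.dualObj D = v := by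
  obtain ⟨x₀, hx₀⟩ := hP
  set z₀ : (Fin n → ℝ) × Matrix (Fin n) (Fin n) ℝ := (x₀, vecMulVec x₀ x₀) with hz₀
  have hz₀s : z₀ ∈ P.sdpFeasible := P.mem_sdpFeasible_of_mem_feasibleSet hl hx₀
  obtain ⟨hz₀p, hz₀c⟩ := (P.mem_sdpFeasible_iff z₀).1 hz₀s
  have hd₀ : P.diagSum z₀ ≤ 0 := Finset.sum_nonpos fun i _ => hz₀c (.inr (.inl i))
  set c : ℝ := frob P.Q₀ z₀.2 + P.c₀ ⬝ᵥ z₀.1 - v with hc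
  have hc0 : 0 < c := by
    have := h z₀ hz₀s
    linarith
  have hε : 0 < v' - v := sub_pos.2 hv
  set H : ℝ := ∑ i, (P.u i - P.l i) ^ 2 with hH
  have hH0 : 0 ≤ H := Finset.sum_nonneg fun i _ => sq_nonneg _
  -- Since `diagSum` ≥ -H, adding c/R times it costs at most cH/R; this R keeps that within the gap
  -- v' - v.
  set R : ℝ := 1 + c * H / (v' - v) with hR
  have hR0 : 0 < R := by positivity
  have hRH : c / R * H ≤ v' - v := by
    have h1 : c * H / (v' - v) ≤ R := by linarith
    rw [div_le_iff₀ hε] at h1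
    rw [div_mul_eq_mul_div, div_le_iff₀ hR0]
    linarith
  have hf : ∀ a : ℝ, IsAffineOnSymm
      fun z : (Fin n → ℝ) × Matrix (Fin n) (Fin n) ℝ => frob P.Q₀ z.2 + P.c₀ ⬝ᵥ z.1 - a :=
    fun a => ⟨P.Q₀, P.c₀, -a, fun z _ => sub_eq_add_neg _ _⟩
  have hg := P.isAffineOnSymm_constraint
  have hsub : psdSet n ∩ {z | P.diagSum z ≤ R} ⊆ psdSet n := Set.inter_subset_left
  have hconv : Convex ℝ (psdSet n ∩ {z | P.diagSum z ≤ R}) := by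
    rintro z ⟨hz, hzR⟩ w ⟨hw, hwR⟩ a b ha hb hab
    refine ⟨convex_psdSet hz hw ha hb hab, ?_⟩
    change P.diagSum _ ≤ R at hzR hwR ⊢
    rw [P.isAffineOnSymm_diagSum.map_combo z hz w hw a b hab]
    calc a * P.diagSum z + b * P.diagSum w ≤ a * R + b * R := by gcongr
      _ = R := by rw [← add_mul, hab, one_mul]
  obtain ⟨k, hk, hkB⟩ := exists_multipliers (P.isCompact_psdSet_inter_diagSum_le R) hconv
    ((hf v').continuousOn.mono hsub) (fun a => (hg a).continuousOn.mono hsub)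
    (fun z hz w hw => (hf v').map_combo z (hsub hz) w (hsub hw))
    (fun a z hz w hw => (hg a).map_combo z (hsub hz) w (hsub hw))
    ⟨z₀, ⟨hz₀p, hd₀.trans hR0.le⟩, hz₀c⟩
    (fun z hz hzc => sub_pos.2 (h z ((P.mem_sdpFeasible_iff z).2 ⟨hz.1, hzc⟩)))
  have hs : 0 ≤ c / R := by positivity
  refine P.exists_dualFeasible_of_le_lagrangian hk hs fun z hz => ?_
  -- On the slice the multipliers give the bound with v', and the gap pays for a negative `diagSum`.
  -- Off the slice the added term pays for the linear decrease.
  by_cases hzR : P.diagSum z ≤ R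
  · have h1 := hkB z ⟨hz, hzR⟩
    have h2 := mul_le_mul_of_nonneg_left (P.neg_sum_sq_le_diagSum hz) hs
    linarith
  · have hq : IsAffineOnSymm fun z : (Fin n → ℝ) × Matrix (Fin n) (Fin n) ℝ =>
        frob P.Q₀ z.2 + P.c₀ ⬝ᵥ z.1 - v + ∑ a, k a * P.constraint a z :=
      (hf v).add (IsAffineOnSymm.sum _ fun a _ => (hg a).const_mul (k a))
    have hq₀ : frob P.Q₀ z₀.2 + P.c₀ ⬝ᵥ z₀.1 - v + ∑ a, k a * P.constraint a z₀ ≤ c := by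
      have : ∑ a, k a * P.constraint a z₀ ≤ 0 :=
        Finset.sum_nonpos fun a _ => mul_nonpos_of_nonneg_of_nonpos (hk a) (hz₀c a)
      linarith
    have h1 := nonneg_add_mul_of_nonneg_of_le
      (q := fun z => frob P.Q₀ z.2 + P.c₀ ⬝ᵥ z.1 - v + ∑ a, k a * P.constraint a z)
      convex_psdSet hR0 hq.map_combo
      P.isAffineOnSymm_diagSum.map_combo hz₀p hd₀ hq₀
      (fun w hw hwR => by
        have := hkB w ⟨hw, hwR⟩
        linarith) hz (not_le.1 hzR)
    linarith

/-- Only reals strictly below v(SDP) are shown to be dual values; the optimality of `D` turns this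
into the inequality. -/
theorem sdpValue_le_dualObj (hl : ∀ i, 0 ≤ P.l i) (hP : P.feasibleSet.Nonempty)
    {D : DualVars n m} (hD : P.IsDualOptimal D) : P.sdpValue ≤ P.dualObj D := by
  by_contra hlt
  push Not at hlt
  obtain ⟨v', h1, h2⟩ := EReal.lt_iff_exists_real_btwn.1 hlt
  obtain ⟨v, hv1, hv2⟩ := exists_between (EReal.coe_lt_coe_iff.1 h1)
  obtain ⟨D', hD', hobj⟩ := P.exists_dualFeasible_of_lt hl hP hv2 fun z hz =>
    EReal.coe_lt_coe_iff.1 (h2.trans_le (iInf₂_le z hz))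
  have := hD.2 D' hD'
  linarith

end QCQP

end

theorem corollary1 {n m : ℕ} (P : QCQP n m) (hl : ∀ i, 0 ≤ P.l i)
    (hP : P.feasibleSet.Nonempty)
    (D : QCQP.DualVars n m) (hD : P.IsDualOptimal D) :
    P.IsOptSolution (P.Q₀ + ∑ r, D.α r • P.Q r + QCQP.Phi D + P.Delta D) (fun _ => 0) ∧
    P.optOptValue =
      P.relaxValue (P.Q₀ + ∑ r, D.α r • P.Q r + QCQP.Phi D + P.Delta D) (fun _ => 0) ∧
    P.relaxValue (P.Q₀ + ∑ r, D.α r • P.Q r + QCQP.Phi D + P.Delta D) (fun _ => 0) =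
      P.sdpValue ∧
    P.starValue D = P.sdpValue := by
  have hlu : P.l ≤ P.u := fun i => by
    obtain ⟨x, hx⟩ := hP
    exact (hx.2 i).1.trans (hx.2 i).2
  have hfeas : QCQP.OptFeasible (P.Q₀ + ∑ r, D.α r • P.Q r + QCQP.Phi D + P.Delta D)
      (fun _ : Fin m => 0) :=
    ⟨QCQP.posSemidef_of_bordered hD.1.2.2.2.2.2.2, fun _ => PosSemidef.zero⟩
  have h1 := P.sdpValue_le_dualObj hl hP hD
  have h2 := P.dualObj_le_starValue hD.1
  have h3 := P.starValue_le_relaxValue D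
  have h4 := P.relaxValue_le_sdpValue hlu hfeas
  have hrelax := le_antisymm h4 ((h1.trans h2).trans h3)
  have hopt : ∀ S₀ S, QCQP.OptFeasible S₀ S → P.relaxValue S₀ S ≤
      P.relaxValue (P.Q₀ + ∑ r, D.α r • P.Q r + QCQP.Phi D + P.Delta D) (fun _ => 0) :=
    fun S₀ S hS => (P.relaxValue_le_sdpValue hlu hS).trans hrelax.ge
  refine ⟨⟨hfeas, hopt⟩, le_antisymm ?_ ?_, hrelax, le_antisymm (h3.trans h4) (h1.trans h2)⟩
  · exact iSup_le fun S₀ => iSup_le fun S => iSup_le fun hS => hopt S₀ S hS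
  · exact le_iSup_of_le _ (le_iSup_of_le _ (le_iSup_of_le hfeas le_rfl))
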